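/- **Setting.** Let $\mathcal X$ be a finite nonempty set, $m\ge 1$, $n\ge 0$, $\sigma>0$, $\delta\in(0,1)$. Let $h:\mathcal X\to\mathbb R^m$ be a sample of a Gaussian process with mean $\mu_0$ and matrix-valued covariance function $K_0$, and let $\epsilon_1,\epsilon_2,\dots$ be i.i.d. $\mathcal N(0,\sigma^2 I_m)$, independent of $h$. Let $g_0,\dots,g_n:\mathcal X\times\mathbb R^m\to\mathbb R$ be known functions with $|g_i(x,y)-g_i(x,z)|\le L_i\|y-z\|_1$ for all $x,y,z$, and put $f_i(x)=g_i(x,h(x))$. The problem is to maximize $f_0(x)$ over $x\in\mathcal X$ subject to $f_i(x)\ge 0$, $i=1,\dots,n$; when it is feasible, $f_0^\star$ denotes its optimal value. **Algorithm (CUQB).** Given data $\mathcal D_t=\{(x_s,y_s)\}_{s\le t}$, let $\mu_t(x)$, $\Sigma_t(x)$ be the Gaussian-process posterior mean and covariance matrix of $h(x)$, let $Y_{i,t}(x)$ be $g_i(x,W)$ with $W\sim\mathcal N(\mu_t(x),\Sigma_t(x))$, and let $$l_{i,t}(x)=Q_{Y_{i,t}(x)}(\alpha_{i,t}/2),\qquad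 u_{i,t}(x)=Q_{Y_{i,t}(x)}(1-\alpha_{i,t}/2),\qquad \alpha_{i,t}=\frac{6\delta}{\pi^2(t+1)^2(n+1)|\mathcal X|},$$ where $Q_Y(p)=\inf\{y:\Pr(Y\le y)\ge p\}$. If $\max_x u_{i,t}(x)<0$ for some $i\in\{1,\dots,n\}$, infeasibility is declared and the algorithm stops. Otherwise $x_{t+1}$ is a global maximizer of $u_{0,t}$ over $\{x\in\mathcal X: u_{i,t}(x)\ge 0,\ i=1,\dots,n\}$, ties being broken by any measurable rule depending on $\mathcal D_t$ only, and $y_{t+1}=h(x_{t+1})+\epsilon_{t+1}$ is observed. **Quantities.** Let $$R_T=\sum_{t=1}^{T}\bigl(f_0^\star-f_0(x_t)\bigr),\quad R_T^+=\sum_{t=1}^{T}\max\{f_0^\star-f_0(x_t),0\},\quad V_{i,T}=\sum_{t=1}^{T}\max\{-f_i(x_t),0\}.$$ With $k_{j,0}$ the $j$-th diagonal entry of $K_0$, let $$\gamma_{j,T}=\max_{(a_1,\dots,a_T)\in\mathcal X^T}\tfrac12\log\det\bigl(I+\sigma^{-2}[k_{j,0}(a_p,a_q)]_{p,q=1}^T\bigr)$$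 (repeated points allowed), $\gamma_T^{\max}=\max_j\gamma_{j,T}$, $\Psi_T=\sum_{j=1}^m\sqrt{(T+2)\gamma_{j,T}}$ and $\beta_T=2\log\bigl(m\pi^2T^2(n+1)|\mathcal X|/(3\delta)\bigr)$. Write $a_T=\tilde{\mathcal O}(b_T)$ if $a_T=O(b_T(\log T)^k)$ as $T\to\infty$ for some $k\in\mathbb N$. **Theorem.** There is an event $E$ of probability at least $1-\delta$ such that, on $E$, whenever the problem is feasible (in particular, on all of $E$ if the problem is assumed feasible), CUQB never declares infeasibility, the auxiliary problem is feasible at every step, so that all $x_t$ are well defined, and the following hold. 1. $R_T\le R_T^+$ for all $T$. If $k_{j,0}(x,x)\le 1$ for all $j$ and $x$, then for every $T\ge 1$ with $\sigma^2\le 1+2/T$ (hence for every $T\ge1$ if $\sigma^2\le 1$) $$R_T\le R_T^+\le 4L_0\,\beta_T^{1/2}\,\Psi_T,\qquad V_{i,T}\le 4L_i\,\beta_T^{1/2}\,\Psi_T\quad(i=1,\dots,n).$$ 2. These bounds satisfy $4L_i\beta_T^{1/2}\Psi_T=\tilde{\mathcal O}\bigl(\sqrt{\gamma_T^{\max}T}\bigr)$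 for $i=0,\dots,n$. 3. Without any restriction on $k_{j,0}$ and $\sigma>0$, there is a deterministic sequence $B_T=\tilde{\mathcal O}\bigl(\sqrt{\gamma_T^{\max}T}\bigr)$ such that on $E$, whenever the problem is feasible, $R_T\le R_T^+\le B_T$ and $V_{i,T}\le B_T$ for all $T\ge 1$ and $i=1,\dots,n$. -/

import Mathlib

open MeasureTheory ProbabilityTheory Filter

noncomputable section

namespace CUQB

/-- Outputs of the black-box function. -/
abbrev Vec (m : ℕ) : Type := EuclideanSpace ℝ (Fin m)

/-- A data set of `t` pairs (query point, noisy observation), in order of acquisition. -/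
abbrev Data (X : Type*) (m t : ℕ) : Type _ := Fin t → X × Vec m

section GaussianProcess

variable {X : Type*} {m t : ℕ}

/-- `h` is a sample of the multi-output Gaussian process with mean `μ₀` and matrix-valued
covariance `K₀`. -/
structure IsGPSample {Ω : Type*} [MeasurableSpace Ω] (P : Measure Ω)
    (μ₀ : X → Vec m) (K₀ : X → X → Matrix (Fin m) (Fin m) ℝ) (h : X → Ω → Vec m) : Prop where
  measurable : ∀ x, Measurable (h x)
  gaussian : IsGaussianProcess h P
  mean : ∀ x j, ∫ ω, h x ω j ∂P = μ₀ x j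
  cov : ∀ x x' j l, cov[fun ω => h x ω j, fun ω => h x' ω l; P] = K₀ x x' j l

/-- `ε t` is the noise in the `(t+1)`-st observation: i.i.d. `N(0, σ² I)`, independent of `h`. -/
structure IsGaussianNoise {Ω : Type*} [MeasurableSpace Ω] (P : Measure Ω) (σ : ℝ)
    (h : X → Ω → Vec m) (ε : ℕ → Ω → Vec m) : Prop where
  measurable : ∀ t, Measurable (ε t)
  law : ∀ t, P.map (ε t) = multivariateGaussian 0 (σ ^ 2 • (1 : Matrix (Fin m) (Fin m) ℝ))
  indep : iIndepFun ε P
  indep_sample : IndepFun (fun ω x => h x ω) (fun ω t => ε t ω) P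

/-- Covariance matrix of the stacked noisy observations at `D`. -/
def noisyGram (K₀ : X → X → Matrix (Fin m) (Fin m) ℝ) (σ : ℝ) (D : Data X m t) :
    Matrix (Fin t × Fin m) (Fin t × Fin m) ℝ :=
  Matrix.of (fun p q => K₀ (D p.1).1 (D q.1).1 p.2 q.2) + σ ^ 2 • 1

/-- Covariance between `h z` and the stacked observations at `D`. -/
def crossCov (K₀ : X → X → Matrix (Fin m) (Fin m) ℝ) (D : Data X m t) (z : X) :
    Matrix (Fin m) (Fin t × Fin m) ℝ :=
  Matrix.of fun j q => K₀ z (D q.1).1 j q.2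

/-- Posterior mean of `h z` given `D`. -/
def postMean (μ₀ : X → Vec m) (K₀ : X → X → Matrix (Fin m) (Fin m) ℝ) (σ : ℝ)
    (D : Data X m t) (z : X) : Vec m :=
  μ₀ z + WithLp.toLp 2
    ((crossCov K₀ D z * (noisyGram K₀ σ D)⁻¹).mulVec fun q => (D q.1).2 q.2 - μ₀ (D q.1).1 q.2)

/-- Posterior covariance matrix of `h z` given `D`. -/
def postCov (K₀ : X → X → Matrix (Fin m) (Fin m) ℝ) (σ : ℝ) (D : Data X m t) (z : X) :
    Matrix (Fin m) (Fin m) ℝ :=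
  K₀ z z - crossCov K₀ D z * (noisyGram K₀ σ D)⁻¹ * (crossCov K₀ D z).transpose

/-- Information gain about the `j`-th output from noisy measurements of it at the points `a`. -/
def infoGain (K₀ : X → X → Matrix (Fin m) (Fin m) ℝ) (σ : ℝ) (j : Fin m) (a : Fin t → X) : ℝ :=
  1 / 2 * Real.log
    (1 + (σ ^ 2)⁻¹ • Matrix.of (fun p q => K₀ (a p) (a q) j j) : Matrix (Fin t) (Fin t) ℝ).det

/-- Maximum information gain `γ_{j,t}`: the maximum over all choices of `t` measurement points,
where a point may be measured more than once. -/
def maxInfoGain (K₀ : X → X → Matrix (Fin m) (Fin m) ℝ) (σ : ℝ) (j : Fin m) (t : ℕ) : ℝ :=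
  ⨆ a : Fin t → X, infoGain K₀ σ j a

/-- `γ_t^max = max_j γ_{j,t}`. -/
def maxInfoGainMax (K₀ : X → X → Matrix (Fin m) (Fin m) ℝ) (σ : ℝ) (t : ℕ) : ℝ :=
  ⨆ j : Fin m, maxInfoGain K₀ σ j t

/-- `Ψ_T = ∑_j √((T+2) γ_{j,T})`. -/
def Psi (K₀ : X → X → Matrix (Fin m) (Fin m) ℝ) (σ : ℝ) (T : ℕ) : ℝ :=
  ∑ j : Fin m, Real.sqrt ((T + 2) * maxInfoGain K₀ σ j T)

end GaussianProcess

/-- Quantile function (generalized inverse of the distribution function) of a law on `ℝ`. -/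
def quantile (ν : Measure ℝ) (p : ℝ) : ℝ := sInf {y : ℝ | p ≤ ν.real (Set.Iic y)}

/-- The probability levels `α_{i,t} = 6δ / (π² (t+1)² (n+1) |X|)` (the same for all `i`). -/
def level (X : Type*) [Fintype X] (n : ℕ) (δ : ℝ) (t : ℕ) : ℝ :=
  6 * δ / (Real.pi ^ 2 * (t + 1) ^ 2 * (n + 1) * Fintype.card X)

/-- `β_t = 2 log (m π² t² (n+1) |X| / (3δ))`. -/
def beta (X : Type*) [Fintype X] (m n : ℕ) (δ : ℝ) (t : ℕ) : ℝ :=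
  2 * Real.log (m * Real.pi ^ 2 * t ^ 2 * (n + 1) * Fintype.card X / (3 * δ))

section Algorithm

variable {X : Type*} {m n t : ℕ}

/-- Law of the prediction `Y_{i,t}(z) = g_i(z, μ_t(z) + C_t(z) Z)`, where `Z` is standard normal
and `C_t(z) C_t(z)ᵀ = Σ_t(z)`. -/
def predLaw (μ₀ : X → Vec m) (K₀ : X → X → Matrix (Fin m) (Fin m) ℝ) (σ : ℝ)
    (g : Fin (n + 1) → X → Vec m → ℝ) (i : Fin (n + 1)) (D : Data X m t) (z : X) : Measure ℝ :=
  (multivariateGaussian (postMean μ₀ K₀ σ D z) (postCov K₀ σ D z)).map (g i z)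

/-- Upper quantile bound `u_{i,t}(z)` given the data `D`. -/
def upper [Fintype X] (μ₀ : X → Vec m) (K₀ : X → X → Matrix (Fin m) (Fin m) ℝ) (σ δ : ℝ)
    (g : Fin (n + 1) → X → Vec m → ℝ) (i : Fin (n + 1)) (D : Data X m t) (z : X) : ℝ :=
  quantile (predLaw μ₀ K₀ σ g i D z) (1 - level X n δ t / 2)

/-- Line 2 of the algorithm: the test by which infeasibility is declared. As `X` is finite,
`max_z u_{i,t}(z) < 0` says that `u_{i,t}(z) < 0` for all `z`. -/
def DeclaresInfeasible [Fintype X] (μ₀ : X → Vec m) (K₀ : X → X → Matrix (Fin m) (Fin m) ℝ)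
    (σ δ : ℝ) (g : Fin (n + 1) → X → Vec m → ℝ) (D : Data X m t) : Prop :=
  ∃ i : Fin n, ∀ z, upper μ₀ K₀ σ δ g i.succ D z < 0

/-- Feasible set of the auxiliary problem. -/
def auxFeasible [Fintype X] (μ₀ : X → Vec m) (K₀ : X → X → Matrix (Fin m) (Fin m) ℝ)
    (σ δ : ℝ) (g : Fin (n + 1) → X → Vec m → ℝ) (D : Data X m t) : Set X :=
  {z | ∀ i : Fin n, 0 ≤ upper μ₀ K₀ σ δ g i.succ D z}

/-- `x` is a global maximizer of the auxiliary problem: maximize `u_{0,t}` subject to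
`u_{i,t} ≥ 0` for `i = 1, …, n`. -/
def IsAuxMaximizer [Fintype X] (μ₀ : X → Vec m) (K₀ : X → X → Matrix (Fin m) (Fin m) ℝ)
    (σ δ : ℝ) (g : Fin (n + 1) → X → Vec m → ℝ) (D : Data X m t) (x : X) : Prop :=
  x ∈ auxFeasible μ₀ K₀ σ δ g D ∧
    IsMaxOn (upper μ₀ K₀ σ δ g 0 D) (auxFeasible μ₀ K₀ σ δ g D) x

/-- A query rule of CUQB: a measurable map from data to the next query point that returns a global
maximizer of the auxiliary problem whenever that problem is feasible, with ties broken in any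
way. Where the auxiliary problem is infeasible the algorithm has no next point, and the value of
the rule is left arbitrary. -/
structure IsQueryRule [Fintype X] [MeasurableSpace X] (μ₀ : X → Vec m)
    (K₀ : X → X → Matrix (Fin m) (Fin m) ℝ) (σ δ : ℝ) (g : Fin (n + 1) → X → Vec m → ℝ)
    (rule : (t : ℕ) → Data X m t → X) : Prop where
  measurable : ∀ t, Measurable (rule t)
  isAuxMaximizer : ∀ (t : ℕ) (D : Data X m t), (auxFeasible μ₀ K₀ σ δ g D).Nonempty →
    IsAuxMaximizer μ₀ K₀ σ δ g D (rule t D)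

/-- The data `D_t` collected by a query rule when the black-box function is `f` and the noise
sequence is `e`: the point `rule t D_t` is queried and `f (rule t D_t) + e t` is observed. -/
def dataset (rule : (t : ℕ) → Data X m t → X) (f : X → Vec m) (e : ℕ → Vec m) :
    (t : ℕ) → Data X m t
  | 0 => Fin.elim0
  | t + 1 => Fin.snoc (α := fun _ => X × Vec m) (dataset rule f e t)
      (rule t (dataset rule f e t), f (rule t (dataset rule f e t)) + e t)

/-- The query point `x_{t+1}`. -/
def query (rule : (t : ℕ) → Data X m t → X) (f : X → Vec m) (e : ℕ → Vec m) (t : ℕ) : X :=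
  rule t (dataset rule f e t)

end Algorithm

section Performance

variable {X : Type*} {m n : ℕ}

/-- Feasible set of the original problem when the black-box function is `f`. -/
def feasibleSet (g : Fin (n + 1) → X → Vec m → ℝ) (f : X → Vec m) : Set X :=
  {x | ∀ i : Fin n, 0 ≤ g i.succ x (f x)}

/-- Optimal value `f₀⋆` of the original problem (a maximum when the feasible set is finite and
nonempty). -/
def optValue (g : Fin (n + 1) → X → Vec m → ℝ) (f : X → Vec m) : ℝ :=
  sSup ((fun x => g 0 x (f x)) '' feasibleSet g f)

/-- Cumulative regret `R_T`; here and below `x t` is the point `x_{t+1}`. -/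
def cumRegret (g : Fin (n + 1) → X → Vec m → ℝ) (f : X → Vec m) (x : ℕ → X) (T : ℕ) : ℝ :=
  ∑ t ∈ Finset.range T, (optValue g f - g 0 (x t) (f (x t)))

/-- Cumulative positive regret `R_T⁺`. -/
def cumPosRegret (g : Fin (n + 1) → X → Vec m → ℝ) (f : X → Vec m) (x : ℕ → X) (T : ℕ) : ℝ :=
  ∑ t ∈ Finset.range T, max (optValue g f - g 0 (x t) (f (x t))) 0

/-- Cumulative violation `V_{i,T}` of the `i`-th constraint. -/
def cumViolation (g : Fin (n + 1) → X → Vec m → ℝ) (f : X → Vec m) (x : ℕ → X) (i : Fin n)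
    (T : ℕ) : ℝ :=
  ∑ t ∈ Finset.range T, max (-g i.succ (x t) (f (x t))) 0

end Performance

/-- `a_T = Õ(b_T)`: big-O as `T → ∞` up to a power of `log T`. -/
def IsSoftO (a b : ℕ → ℝ) : Prop :=
  ∃ k : ℕ, a =O[atTop] fun T => b T * Real.log T ^ k

end CUQB

end

/-! Everything happens on one event, built in `exists_confidence_event`: for all times and points,
every upper quantile dominates the true value, and `h z` lies within ℓ¹ distance `√β_{t+1} ∑ⱼ
√(Σ_t(z)ⱼⱼ)` of the posterior mean. Given the data, each statement fails with probability at most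
`α_t / 2`, the first by definition of a quantile, the second by Gaussian tails; the union bound sums
to `δ` because `ζ(2) = π²/6`.

The query points depend on the noise, so the Gaussian conditioning formulas are not immediately
available. `measure_dataset_le` splits according to the finitely many query sequences. For a fixed
sequence, Gaussian regression (`residual_law`) makes the residual independent of the observations,
while whether the rule follows that sequence is decided by the observations alone. These events are
disjoint, so no factor is lost.

On the event, the optimizer remains feasible for the auxiliary problem, so `f₀⋆ ≤ u₀(x_{t+1})`; also
`u_i(x_{t+1}) ≥ 0`. Hence regret and violation are at most `u_i - f_i`. The Gaussian tail bound also
controls the quantile itself (`upper_le`), so this gap is at most `2 L_i √β ∑ⱼ √(Σ_t)ⱼⱼ`.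

To sum over time, use Cauchy–Schwarz and replace the variance of output `j` by its variance given
output `j` alone, which is no smaller. Since `s ≤ (σ² + κ/2) log(1 + s/σ²)` for `0 ≤ s ≤ κ`, and the
logarithms telescope through Schur complements to twice the information gain
(`sum_log_scalarPostVar`), the variances sum to at most `(2σ² + κ) γ_{j,T}`. -/

namespace CUQB

open Matrix

/-! ### Schur complements and scalar posterior variances -/

section LinearAlgebra

variable {ι : Type*} [Fintype ι] [DecidableEq ι]

/-- Completing the square: the form of `G` at `w - G⁻¹ c` is nonnegative. Thus any trial weight `w`
bounds the explained variance from below. -/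
theorem two_mul_dotProduct_sub_le {G : Matrix ι ι ℝ} (hG : G.PosDef) (c w : ι → ℝ) :
    2 * (w ⬝ᵥ c) - w ⬝ᵥ G *ᵥ w ≤ c ⬝ᵥ G⁻¹ *ᵥ c := by
  have hdet : IsUnit G.det := (Matrix.isUnit_iff_isUnit_det _).1 hG.isUnit
  have h0 := hG.posSemidef.dotProduct_mulVec_nonneg (w - G⁻¹ *ᵥ c)
  have hGc : G *ᵥ (G⁻¹ *ᵥ c) = c := by
    rw [Matrix.mulVec_mulVec, Matrix.mul_nonsing_inv _ hdet, Matrix.one_mulVec]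
  have hsymm : (G⁻¹ *ᵥ c) ⬝ᵥ G *ᵥ w = w ⬝ᵥ c := by
    have hT : Gᵀ = G := by simpa using hG.isHermitian.eq
    rw [Matrix.dotProduct_mulVec, ← Matrix.mulVec_transpose, hT, hGc, dotProduct_comm]
  simp only [star_trivial, Matrix.mulVec_sub, dotProduct_sub, sub_dotProduct, hGc, hsymm] at h0
  rw [dotProduct_comm c]
  linarith

/-- Gram matrix of scalar noisy observations. -/
noncomputable def scalarGram {X : Type*} {t : ℕ} (k : X → X → ℝ) (σ : ℝ) (a : Fin t → X) :
    Matrix (Fin t) (Fin t) ℝ :=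
  Matrix.of (fun p q => k (a p) (a q)) + σ ^ 2 • 1

/-- Posterior variance of a scalar Gaussian process at `z` after noisy observations at `a`. -/
noncomputable def scalarPostVar {X : Type*} {t : ℕ} (k : X → X → ℝ) (σ : ℝ) (a : Fin t → X) (z : X) : ℝ :=
  k z z - (fun p => k z (a p)) ⬝ᵥ (scalarGram k σ a)⁻¹ *ᵥ fun p => k z (a p)

theorem posDef_add_sq_smul_one {ι : Type*} [DecidableEq ι] {G : Matrix ι ι ℝ} (hG : G.PosSemidef) {σ : ℝ} (hσ : 0 < σ) :
    (G + σ ^ 2 • (1 : Matrix ι ι ℝ)).PosDef :=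
  Matrix.PosDef.posSemidef_add hG (Matrix.PosDef.one.smul (by positivity))

variable {X : Type*} {k : X → X → ℝ} {σ : ℝ}

theorem scalarGram_posDef (hk : ∀ (t : ℕ) (a : Fin t → X),
      (Matrix.of fun p q => k (a p) (a q)).PosSemidef) (hσ : 0 < σ) {t : ℕ} (a : Fin t → X) :
    (scalarGram k σ a).PosDef :=
  posDef_add_sq_smul_one (hk t a) hσ

theorem scalarPostVar_le (hk : ∀ (t : ℕ) (a : Fin t → X),
      (Matrix.of fun p q => k (a p) (a q)).PosSemidef) (hσ : 0 < σ) {t : ℕ} (a : Fin t → X)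
    (z : X) : scalarPostVar k σ a z ≤ k z z := by
  have := two_mul_dotProduct_sub_le (scalarGram_posDef hk hσ a) (fun p => k z (a p)) 0
  simp only [zero_dotProduct, mul_zero, sub_zero] at this
  unfold scalarPostVar
  linarith

/-- Schur's determinant formula for the block of the first `t` points; the last factor is the
predictive variance of the next noisy observation. -/
theorem det_scalarGram_succ (hk : ∀ (t : ℕ) (a : Fin t → X),
      (Matrix.of fun p q => k (a p) (a q)).PosSemidef) (hσ : 0 < σ) {t : ℕ} (a : Fin (t + 1) → X) :
    (scalarGram k σ a).det = (scalarGram k σ fun p : Fin t => a p.castSucc).det *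
      (σ ^ 2 + scalarPostVar k σ (fun p : Fin t => a p.castSucc) (a (Fin.last t))) := by
  -- Symmetry of the kernel is read off the two-point Gram matrix.
  have hsymm : ∀ x y, k x y = k y x := fun x y => by
    simpa using congrFun (congrFun (hk 2 ![x, y]).isHermitian.eq 1) 0
  set M := scalarGram k σ fun p : Fin t => a p.castSucc with hM
  have hMd : M.PosDef := scalarGram_posDef hk hσ _
  set z := a (Fin.last t)
  set b : Fin t → ℝ := fun p => k z (a p.castSucc)
  have hblock : (scalarGram k σ a).submatrix finSumFinEquiv finSumFinEquiv =
      Matrix.fromBlocks M (Matrix.replicateCol (Fin 1) b) (Matrix.replicateRow (Fin 1) b)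
        (Matrix.of fun _ _ => k z z + σ ^ 2) := by
    ext p q
    rcases p with p | p <;> rcases q with q | q
    · simp [scalarGram, hM, Matrix.one_apply, Fin.castAdd, Fin.ext_iff, Fin.castSucc]
    · obtain rfl : q = 0 := Subsingleton.elim _ _
      have : (Fin.natAdd t (0 : Fin 1)) = Fin.last t := rfl
      have h2 : Fin.castAdd 1 p = p.castSucc := rfl
      simp [scalarGram, this, h2, b, z, hsymm (a p.castSucc),
        (Fin.castSucc_lt_last p).ne]
    · obtain rfl : p = 0 := Subsingleton.elim _ _
      have : (Fin.natAdd t (0 : Fin 1)) = Fin.last t := rfl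
      have h2 : Fin.castAdd 1 q = q.castSucc := rfl
      simp [scalarGram, this, h2, b, z, (Fin.castSucc_lt_last q).ne']
    · obtain rfl : p = 0 := Subsingleton.elim _ _
      obtain rfl : q = 0 := Subsingleton.elim _ _
      have : (Fin.natAdd t (0 : Fin 1)) = Fin.last t := rfl
      simp [scalarGram, this, z]
  have : Invertible M := hMd.isUnit.invertible
  rw [← Matrix.det_submatrix_equiv_self finSumFinEquiv, hblock, Matrix.det_fromBlocks₁₁]
  congr 1
  rw [Matrix.det_unique]
  simp only [scalarPostVar, Matrix.sub_apply, Matrix.of_apply, Matrix.invOf_eq_nonsing_inv]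
  rw [Matrix.mul_assoc, ← Matrix.replicateCol_mulVec, Matrix.replicateRow_mul_replicateCol_apply]
  ring

end LinearAlgebra

/-! ### Information gain and sums of posterior variances -/

section InfoGain

variable {X : Type*} {m : ℕ} {K₀ : X → X → Matrix (Fin m) (Fin m) ℝ} {σ : ℝ}

theorem infoGain_eq (hσ : 0 < σ) (j : Fin m) {t : ℕ} (a : Fin t → X)
    (hd : 0 < (scalarGram (fun x y => K₀ x y j j) σ a).det) :
    infoGain K₀ σ j a =
      1 / 2 * (Real.log (scalarGram (fun x y => K₀ x y j j) σ a).det - t * Real.log (σ ^ 2)) := by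
  have : (1 + (σ ^ 2)⁻¹ • Matrix.of (fun p q => K₀ (a p) (a q) j j) : Matrix (Fin t) (Fin t) ℝ) =
      (σ ^ 2)⁻¹ • scalarGram (fun x y => K₀ x y j j) σ a := by
    rw [scalarGram, smul_add, smul_smul, inv_mul_cancel₀ (by positivity), one_smul, add_comm]
  rw [infoGain, this, Matrix.det_smul, Real.log_mul (by positivity) hd.ne', Real.log_pow,
    Real.log_inv, Fintype.card_fin]
  ring

/-- Chain rule for information: each new point multiplies the determinant by its predictive
variance, so the logarithms telescope. -/
theorem sum_log_scalarPostVar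
    (hK : ∀ (j : Fin m) (t : ℕ) (a : Fin t → X),
      (Matrix.of fun p q => K₀ (a p) (a q) j j).PosSemidef)
    (hσ : 0 < σ) (j : Fin m) (x : ℕ → X) (T : ℕ)
    (h0 : ∀ t, 0 ≤ scalarPostVar (fun x y => K₀ x y j j) σ (fun p : Fin t => x p) (x t)) :
    ∑ t ∈ Finset.range T, Real.log
        (1 + scalarPostVar (fun x y => K₀ x y j j) σ (fun p : Fin t => x p) (x t) / σ ^ 2) =
      2 * infoGain K₀ σ j (fun p : Fin T => x p) := by
  have hd : ∀ t : ℕ, 0 < (scalarGram (fun x y => K₀ x y j j) σ (fun p : Fin t => x p)).det :=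
    fun t => (scalarGram_posDef (hK j) hσ _).det_pos
  induction T with
  | zero => simp [infoGain]
  | succ T ih =>
    rw [Finset.sum_range_succ, ih, infoGain_eq hσ j _ (hd _), infoGain_eq hσ j _ (hd _),
      det_scalarGram_succ (hK j) hσ]
    simp only [Fin.val_castSucc, Fin.val_last]
    have hs := h0 T
    rw [Real.log_mul (hd T).ne' (by positivity)]
    have : 1 + scalarPostVar (fun x y => K₀ x y j j) σ (fun p : Fin T => x p) (x T) / σ ^ 2 =
      (σ ^ 2 + scalarPostVar (fun x y => K₀ x y j j) σ (fun p : Fin T => x p) (x T)) / σ ^ 2 := by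
      field_simp
    rw [this, Real.log_div (by positivity) (by positivity)]
    push_cast
    ring

theorem infoGain_le_maxInfoGain [Finite X] (j : Fin m) {t : ℕ} (a : Fin t → X) :
    infoGain K₀ σ j a ≤ maxInfoGain K₀ σ j t :=
  le_ciSup (Set.finite_range _).bddAbove a

/-- Rests on `log (1 + x) ≥ 2x / (x + 2)` at `x = s / σ²`. The resulting constant is affine in `σ²`
and `k`, convenient for the explicit bounds. -/
theorem le_mul_log_one_add {s k σ : ℝ} (hσ : 0 < σ) (hs : 0 ≤ s) (hk : s ≤ k) :
    s ≤ (σ ^ 2 + k / 2) * Real.log (1 + s / σ ^ 2) := by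
  have hx : 0 ≤ s / σ ^ 2 := by positivity
  have h1 := Real.le_log_one_add_of_nonneg hx
  have h2 : s = (σ ^ 2 + s / 2) * (2 * (s / σ ^ 2) / (s / σ ^ 2 + 2)) := by
    field_simp
    ring
  have h3 : 0 ≤ Real.log (1 + s / σ ^ 2) := Real.log_nonneg (by linarith)
  calc s = (σ ^ 2 + s / 2) * (2 * (s / σ ^ 2) / (s / σ ^ 2 + 2)) := h2
    _ ≤ (σ ^ 2 + s / 2) * Real.log (1 + s / σ ^ 2) := by gcongr
    _ ≤ _ := by gcongr

theorem sum_scalarPostVar_le [Finite X]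
    (hK : ∀ (j : Fin m) (t : ℕ) (a : Fin t → X),
      (Matrix.of fun p q => K₀ (a p) (a q) j j).PosSemidef)
    (hσ : 0 < σ) (j : Fin m) (x : ℕ → X) (T : ℕ)
    (h0 : ∀ t, 0 ≤ scalarPostVar (fun x y => K₀ x y j j) σ (fun p : Fin t => x p) (x t))
    {κ : ℝ} (hκ : ∀ z, K₀ z z j j ≤ κ) :
    ∑ t ∈ Finset.range T, scalarPostVar (fun x y => K₀ x y j j) σ (fun p : Fin t => x p) (x t) ≤
      (2 * σ ^ 2 + κ) * maxInfoGain K₀ σ j T := by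
  have hκ0 : 0 ≤ κ := (h0 0).trans ((scalarPostVar_le (hK j) hσ _ _).trans (hκ _))
  calc _ ≤ ∑ t ∈ Finset.range T, (σ ^ 2 + κ / 2) * Real.log
        (1 + scalarPostVar (fun x y => K₀ x y j j) σ (fun p : Fin t => x p) (x t) / σ ^ 2) :=
        Finset.sum_le_sum fun t _ => le_mul_log_one_add hσ (h0 t)
          ((scalarPostVar_le (hK j) hσ _ _).trans (hκ _))
    _ = (2 * σ ^ 2 + κ) * infoGain K₀ σ j (fun p : Fin T => x p) := by
        rw [← Finset.mul_sum, sum_log_scalarPostVar hK hσ j x T h0]; ring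
    _ ≤ _ := by gcongr; exact infoGain_le_maxInfoGain j _

/-- The posterior variance given all outputs is at most the one given the `j`-th outputs alone. -/
theorem postCov_le_scalarPostVar {t : ℕ} {D : Data X m t}
    (hK : ∀ (j : Fin m) (t : ℕ) (a : Fin t → X),
      (Matrix.of fun p q => K₀ (a p) (a q) j j).PosSemidef)
    (hσ : 0 < σ) (hG : (noisyGram K₀ σ D).PosDef) (z : X) (j : Fin m) :
    postCov K₀ σ D z j j ≤ scalarPostVar (fun x y => K₀ x y j j) σ (fun p => (D p).1) z := by
  set M := scalarGram (fun x y => K₀ x y j j) σ (fun p => (D p).1) with hM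
  set b : Fin t → ℝ := fun p => K₀ z (D p).1 j j with hb
  set v := M⁻¹ *ᵥ b with hv
  have hMd : M.PosDef := scalarGram_posDef (hK j) hσ _
  have hMv : M *ᵥ v = b := by
    rw [hv, Matrix.mulVec_mulVec, Matrix.mul_nonsing_inv _
      ((Matrix.isUnit_iff_isUnit_det _).1 hMd.isUnit), Matrix.one_mulVec]
  -- The optimal weights of the scalar problem, extended by zero to the other outputs, serve as
  -- trial weights for the full one.
  set w : Fin t × Fin m → ℝ := fun q => if q.2 = j then v q.1 else 0 with hw
  set c : Fin t × Fin m → ℝ := crossCov K₀ D z j with hc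
  have h1 := two_mul_dotProduct_sub_le hG c w
  have h2 : w ⬝ᵥ c = v ⬝ᵥ b := by
    simp [dotProduct, Fintype.sum_prod_type, hw, hc, crossCov, hb]
  have h3 : w ⬝ᵥ noisyGram K₀ σ D *ᵥ w = v ⬝ᵥ M *ᵥ v := by
    simp [dotProduct, Matrix.mulVec, Fintype.sum_prod_type, hw, noisyGram, hM, scalarGram,
      Matrix.one_apply, Prod.ext_iff]
  have h4 : postCov K₀ σ D z j j = K₀ z z j j - c ⬝ᵥ (noisyGram K₀ σ D)⁻¹ *ᵥ c := by
    rw [postCov, Matrix.sub_apply, Matrix.mul_assoc, Matrix.mul_apply]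
    rfl
  have h5 : b ⬝ᵥ v = v ⬝ᵥ b := dotProduct_comm _ _
  rw [h4]
  change _ ≤ K₀ z z j j - b ⬝ᵥ v
  rw [h2, h3, hMv] at h1
  linarith

end InfoGain

/-! ### Quantiles -/

section Quantile

/-- Right-continuity of the distribution function makes the infimum attained; `0 < p < 1` makes the
set bounded below and nonempty. -/
theorem quantile_le_iff (ν : Measure ℝ) [IsProbabilityMeasure ν] {p : ℝ} (h0 : 0 < p) (h1 : p < 1)
    (v : ℝ) : quantile ν p ≤ v ↔ p ≤ ν.real (Set.Iic v) := by
  simp only [quantile, ← cdf_eq_real]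
  have hbdd : BddBelow {y | p ≤ cdf ν y} := by
    obtain ⟨b, hb⟩ := ((tendsto_cdf_atBot ν).eventually (gt_mem_nhds h0)).exists
    exact ⟨b, fun y hy => le_of_lt <| lt_of_not_ge fun hyb =>
      absurd (hy.trans (monotone_cdf ν hyb)) (not_le.2 hb)⟩
  have hne : {y | p ≤ cdf ν y}.Nonempty := by
    obtain ⟨b, hb⟩ := ((tendsto_cdf_atTop ν).eventually (lt_mem_nhds h1)).exists
    exact ⟨b, hb.le⟩
  refine ⟨fun h => ?_, fun h => csInf_le hbdd h⟩
  refine le_trans ?_ (monotone_cdf ν h)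
  have hright : Tendsto (cdf ν) (nhdsWithin (sInf {y | p ≤ cdf ν y})
      (Set.Ioi (sInf {y | p ≤ cdf ν y}))) (nhds (cdf ν (sInf {y | p ≤ cdf ν y}))) :=
    ((cdf ν).right_continuous _).mono Set.Ioi_subset_Ici_self
  refine ge_of_tendsto hright ?_
  filter_upwards [self_mem_nhdsWithin] with y hy
  obtain ⟨a, ha, hay⟩ := exists_lt_of_csInf_lt hne hy
  exact le_trans ha (monotone_cdf ν hay.le)

theorem measure_quantile_lt_le (ν : Measure ℝ) [IsProbabilityMeasure ν] {p : ℝ} (h0 : 0 < p)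
    (h1 : p < 1) : ν (Set.Ioi (quantile ν p)) ≤ ENNReal.ofReal (1 - p) := by
  have h := (quantile_le_iff ν h0 h1 _).1 le_rfl
  rw [← ofReal_measureReal, ← Set.compl_Iic, probReal_compl_eq_one_sub measurableSet_Iic]
  exact ENNReal.ofReal_le_ofReal (by linarith)

end Quantile

/-! ### Gaussian tail bounds -/

section GaussianTail

/-- After translating by `s`, compare densities: the cross term in the exponent has a favourable
sign on `x > 0`. Keeping the half-line mass instead of bounding it by one avoids a factor 2 in the
two-sided tail. -/
theorem gaussianReal_Ioi_le {v : NNReal} (hv : v ≠ 0) {s : ℝ} (hs : 0 ≤ s) :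
    gaussianReal 0 v (Set.Ioi s) ≤
      ENNReal.ofReal (Real.exp (-s ^ 2 / (2 * v))) * gaussianReal 0 v (Set.Ioi 0) := by
  have hshift : gaussianReal 0 v (Set.Ioi s) = gaussianReal (-s) v (Set.Ioi 0) := by
    have := gaussianReal_map_sub_const (μ := 0) (v := v) s
    rw [zero_sub] at this
    rw [← this, Measure.map_apply (by fun_prop) measurableSet_Ioi]
    congr 1
    ext x
    simp
  rw [hshift, gaussianReal_apply _ hv, gaussianReal_apply _ hv,
    ← lintegral_const_mul _ (measurable_gaussianPDF _ _)]
  refine setLIntegral_mono' measurableSet_Ioi fun x hx => ?_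
  rw [gaussianPDF, gaussianPDF, ← ENNReal.ofReal_mul (Real.exp_nonneg _)]
  refine ENNReal.ofReal_le_ofReal ?_
  rw [gaussianPDFReal, gaussianPDFReal, mul_left_comm, ← Real.exp_add, ← add_div]
  have hx : 0 < x := hx
  gcongr
  nlinarith [mul_nonneg hs hx.le]

theorem gaussianReal_abs_sub_gt_le (μ : ℝ) (v : NNReal) {c : ℝ} (hc : 0 ≤ c) :
    gaussianReal μ v {x | Real.sqrt v * c < |x - μ|} ≤ ENNReal.ofReal (Real.exp (-c ^ 2 / 2)) := by
  have hshift : gaussianReal μ v {x | Real.sqrt v * c < |x - μ|} =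
      gaussianReal 0 v {x | Real.sqrt v * c < |x|} := by
    have := gaussianReal_map_sub_const (μ := μ) (v := v) μ
    rw [sub_self] at this
    rw [← this, Measure.map_apply (by fun_prop)
      (measurableSet_lt measurable_const (by fun_prop))]
    rfl
  rw [hshift]
  by_cases hv : v = 0
  -- The degenerate law is a Dirac mass at the centre, and the inequality is strict.
  · subst hv
    simp [gaussianReal_zero_var]
  set s := Real.sqrt v * c with hs
  have hs0 : 0 ≤ s := by positivity
  have hneg : ∀ r : ℝ, gaussianReal 0 v (Set.Iio (-r)) = gaussianReal 0 v (Set.Ioi r) := by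
    intro r
    have := gaussianReal_map_neg (μ := 0) (v := v)
    rw [neg_zero] at this
    conv_rhs => rw [← this, Measure.map_apply (by fun_prop) measurableSet_Ioi]
    congr 1
    ext x
    simp
  have hexp : -s ^ 2 / (2 * v) = -c ^ 2 / 2 := by
    have hv' : (v : ℝ) ≠ 0 := by exact_mod_cast hv
    rw [hs, mul_pow, Real.sq_sqrt (NNReal.coe_nonneg v)]
    field_simp
  have h1 := gaussianReal_Ioi_le hv hs0
  rw [hexp] at h1
  have h0 := hneg 0
  rw [neg_zero] at h0
  calc gaussianReal 0 v {x | s < |x|}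
      ≤ gaussianReal 0 v (Set.Ioi s ∪ Set.Iio (-s)) := measure_mono fun x hx => by
        rcases lt_abs.1 (Set.mem_ofPred.1 hx) with h | h
        · exact Or.inl h
        · exact Or.inr (by simpa [lt_neg] using h)
    _ ≤ gaussianReal 0 v (Set.Ioi s) + gaussianReal 0 v (Set.Iio (-s)) := measure_union_le _ _
    _ ≤ ENNReal.ofReal (Real.exp (-c ^ 2 / 2)) * gaussianReal 0 v (Set.Ioi 0) +
        ENNReal.ofReal (Real.exp (-c ^ 2 / 2)) * gaussianReal 0 v (Set.Iio 0) := by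
        rw [hneg, h0]; exact add_le_add h1 h1
    _ = ENNReal.ofReal (Real.exp (-c ^ 2 / 2)) * gaussianReal 0 v (Set.Ioi 0 ∪ Set.Iio 0) := by
        rw [measure_union (by
          rw [Set.disjoint_left]; intro x hx hx'
          exact lt_asymm (Set.mem_Ioi.1 hx) (Set.mem_Iio.1 hx')) measurableSet_Iio, mul_add]
    _ ≤ _ := mul_le_of_le_one_right' prob_le_one

/-- If the ℓ¹ deviation exceeds the sum of the thresholds, some coordinate exceeds its own; a union
bound over coordinates gives the factor `m`. No independence between coordinates is needed. -/
theorem multivariateGaussian_sum_abs_sub_gt_le {m : ℕ} (μ : Vec m)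
    {S : Matrix (Fin m) (Fin m) ℝ} (hS : S.PosSemidef) {c : ℝ} (hc : 0 ≤ c) :
    multivariateGaussian μ S {v | c * ∑ j, Real.sqrt (S j j) < ∑ j, |v j - μ j|} ≤
      m * ENNReal.ofReal (Real.exp (-c ^ 2 / 2)) := by
  calc _ ≤ multivariateGaussian μ S (⋃ j, (fun v : Vec m => v j) ⁻¹'
        {x | Real.sqrt (S j j).toNNReal * c < |x - μ j|}) := measure_mono fun v hv => by
        by_contra hcon
        simp only [Set.mem_iUnion, Set.mem_preimage, Set.mem_ofPred_eq, not_exists, not_lt] at hcon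
        refine absurd (Set.mem_ofPred.1 hv) (not_lt.2 ?_)
        rw [Finset.mul_sum]
        refine Finset.sum_le_sum fun j _ => (hcon j).trans ?_
        rw [Real.coe_toNNReal _ hS.diag_nonneg, mul_comm]
    _ ≤ ∑ j, multivariateGaussian μ S ((fun v : Vec m => v j) ⁻¹'
        {x | Real.sqrt (S j j).toNNReal * c < |x - μ j|}) := measure_iUnion_fintype_le _ _
    _ ≤ ∑ _j : Fin m, ENNReal.ofReal (Real.exp (-c ^ 2 / 2)) := Finset.sum_le_sum fun j _ => by
        rw [(measurePreserving_eval_multivariateGaussian hS).measure_preimage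
          (measurableSet_lt measurable_const (by fun_prop)).nullMeasurableSet]
        exact gaussianReal_abs_sub_gt_le _ _ hc
    _ = _ := by simp

end GaussianTail

/-! ### Gaussian regression -/

section Regression

variable {Ω : Type*} [MeasurableSpace Ω] {P : Measure Ω} [IsProbabilityMeasure P]

theorem posSemidef_covariance {ι : Type*} [Fintype ι] {Z : ι → Ω → ℝ} (hZ : ∀ i, MemLp (Z i) 2 P) :
    (Matrix.of fun i j => cov[Z i, Z j; P]).PosSemidef := by
  refine Matrix.PosSemidef.of_dotProduct_mulVec_nonneg ?_ fun x => ?_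
  · ext i j
    simp [covariance_comm]
  · have hm : ∀ i, MemLp (fun ω => x i * Z i ω) 2 P := fun i => (hZ i).const_mul _
    have : star x ⬝ᵥ (Matrix.of fun i j => cov[Z i, Z j; P]) *ᵥ x =
        Var[fun ω => ∑ i, x i * Z i ω; P] := by
      rw [← covariance_self (by
          exact (Finset.aemeasurable_fun_sum _ fun i _ => (hm i).aemeasurable)),
        covariance_fun_sum_fun_sum hm hm]
      simp only [dotProduct, Matrix.mulVec, Finset.mul_sum, covariance_const_mul_left,
        covariance_const_mul_right, Matrix.of_apply, star_trivial]
      refine Finset.sum_congr rfl fun i _ => Finset.sum_congr rfl fun j _ => by ring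
    rw [this]
    exact variance_nonneg _ _

variable {m : ℕ} {ι : Type*} [Fintype ι] [DecidableEq ι]

/-- Gaussian regression: the residual is independent of the regressors, and its law is the centred
Gaussian law whose covariance is the Schur complement. -/
theorem gaussian_regression {H : Ω → Vec m} {Y : ι → Ω → ℝ}
    (hHY : HasGaussianLaw (fun ω => (H ω, fun i => Y i ω)) P)
    {G : Matrix ι ι ℝ} (hG : IsUnit G.det) {C : Matrix (Fin m) ι ℝ} {K : Matrix (Fin m) (Fin m) ℝ}
    (hYY : ∀ p q, cov[Y p, Y q; P] = G p q)
    (hHYc : ∀ j q, cov[fun ω => H ω j, Y q; P] = C j q)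
    (hHH : ∀ j l, cov[fun ω => H ω j, fun ω => H ω l; P] = K j l)
    {μ : Vec m} {ν : ι → ℝ} (hμ : ∀ j, ∫ ω, H ω j ∂P = μ j) (hν : ∀ q, ∫ ω, Y q ω ∂P = ν q)
    {R : Ω → Vec m}
    (hR : ∀ ω, R ω = H ω - (μ + WithLp.toLp 2 ((C * G⁻¹) *ᵥ fun q => Y q ω - ν q))) :
    (K - C * G⁻¹ * Cᵀ).PosSemidef ∧ IndepFun (fun ω i => Y i ω) R P ∧
      P.map R = multivariateGaussian 0 (K - C * G⁻¹ * Cᵀ) := by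
  set A := C * G⁻¹ with hA
  have hH : HasGaussianLaw H P := hHY.fst
  have hY : HasGaussianLaw (fun ω i => Y i ω) P := hHY.snd
  have hHm : ∀ j, MemLp (fun ω => H ω j) 2 P := fun j =>
    (hH.map (EuclideanSpace.proj (𝕜 := ℝ) j)).memLp_two
  have hYm : ∀ q, MemLp (Y q) 2 P := fun q => (hY.eval q).memLp_two
  have hRj : ∀ j, (fun ω => R ω j) =
      fun ω => H ω j - ((∑ q, A j q * (Y q ω)) + (μ j - ∑ q, A j q * ν q)) := by
    intro j
    ext ω
    simp only [hR, PiLp.sub_apply, PiLp.add_apply, Matrix.mulVec, dotProduct, mul_sub,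
      Finset.sum_sub_distrib]
    ring
  have hsm : ∀ j, MemLp (fun ω => ∑ q, A j q * (Y q ω)) 2 P := fun j =>
    memLp_finsetSum _ fun q _ => (hYm q).const_mul _
  have hsm' : ∀ j, MemLp (fun ω => (∑ q, A j q * (Y q ω)) + (μ j - ∑ q, A j q * ν q)) 2 P :=
    fun j => (hsm j).add (memLp_const _)
  have hRm : ∀ j, MemLp (fun ω => R ω j) 2 P := fun j => by
    rw [hRj]; exact (hHm j).sub (hsm' j)
  have hcovL : ∀ j (Z : Ω → ℝ), MemLp Z 2 P → cov[fun ω => R ω j, Z; P] =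
      cov[fun ω => H ω j, Z; P] - ∑ q, A j q * cov[Y q, Z; P] := by
    intro j Z hZ
    rw [hRj, covariance_fun_sub_left (hHm j) (hsm' j) hZ,
      covariance_add_const_left ((hsm j).integrable (by norm_num)),
      covariance_fun_sum_left (fun q => (hYm q).const_mul _) hZ]
    simp_rw [covariance_const_mul_left]
  -- The normal equations: they make the residual uncorrelated with the regressors.
  have hAG : A * G = C := by rw [hA, Matrix.mul_assoc, Matrix.nonsing_inv_mul _ hG, Matrix.mul_one]
  have hRY : ∀ j p, cov[fun ω => R ω j, Y p; P] = 0 := by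
    intro j p
    rw [hcovL j _ (hYm p), hHYc]
    simp_rw [hYY]
    rw [← Matrix.mul_apply, hAG, sub_self]
  have hRR : ∀ j l, cov[fun ω => R ω j, fun ω => R ω l; P] = (K - A * Cᵀ) j l := by
    intro j l
    -- Expand one residual at a time; after the first expansion the regressor terms vanish by `hRY`.
    rw [covariance_comm, hcovL l _ (hRm j), covariance_comm, hcovL j _ (hHm l), hHH]
    simp_rw [covariance_comm (Y _) (fun ω => R ω j), hRY, mul_zero, Finset.sum_const_zero, sub_zero,
      covariance_comm (Y _) (fun ω => H ω l), hHYc]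
    rw [Matrix.sub_apply, Matrix.mul_apply]
    rfl
  have hS : (K - A * Cᵀ).PosSemidef := by
    have := posSemidef_covariance hRm
    simp_rw [hRR] at this
    exact this
  let B : (ι → ℝ) →L[ℝ] Vec m :=
    ((PiLp.continuousLinearEquiv 2 ℝ fun _ : Fin m => ℝ).symm : (Fin m → ℝ) →L[ℝ] Vec m) ∘L
      (LinearMap.toContinuousLinearMap (Matrix.toLin' A))
  have hRlin : ∀ ω, R ω = (H ω - B fun i => Y i ω) + -(μ - B ν) := by
    intro ω
    ext j
    simp only [hR, B, PiLp.sub_apply, PiLp.add_apply, PiLp.neg_apply, Matrix.mulVec, dotProduct,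
      mul_sub, Finset.sum_sub_distrib]
    simp [Matrix.mulVec, dotProduct]
    ring
  have hjoint : HasGaussianLaw (fun ω => (R ω, fun i => Y i ω)) P := by
    let Φ : (Vec m × (ι → ℝ)) →L[ℝ] (Vec m × (ι → ℝ)) :=
      ((ContinuousLinearMap.fst ℝ _ _) - B ∘L (ContinuousLinearMap.snd ℝ _ _)).prod
        (ContinuousLinearMap.snd ℝ _ _)
    have h1 := (hHY.map Φ)
    have h2 : (fun ω => (R ω, fun i => Y i ω)) =
        fun ω => (Φ ∘ fun ω => (H ω, fun i => Y i ω)) ω + (-(μ - B ν), 0) := by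
      ext ω : 1
      simp [Φ, hRlin]
    rw [h2]
    have hmeas : AEMeasurable (Φ ∘ fun ω => (H ω, fun i => Y i ω)) P := h1.aemeasurable
    constructor
    have h3 := h1.isGaussian_map
    have : P.map (fun ω => (Φ ∘ fun ω => (H ω, fun i => Y i ω)) ω + (-(μ - B ν), 0)) =
        (P.map (Φ ∘ fun ω => (H ω, fun i => Y i ω))).map (fun x => x + (-(μ - B ν), 0)) := by
      rw [AEMeasurable.map_map_of_aemeasurable (by fun_prop) hmeas]
      rfl
    rw [this]
    infer_instance
  have hRg : HasGaussianLaw R P := hjoint.fst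
  refine ⟨hS, ?_, ?_⟩
  -- For jointly Gaussian vectors, vanishing cross-covariances give independence.
  · have hjoint' : HasGaussianLaw (fun ω => (fun i => Y i ω, fun j => R ω j)) P := by
      let Φ : (Vec m × (ι → ℝ)) →L[ℝ] ((ι → ℝ) × (Fin m → ℝ)) :=
        (ContinuousLinearMap.snd ℝ _ _).prod
          (((PiLp.continuousLinearEquiv 2 ℝ fun _ : Fin m => ℝ) : Vec m →L[ℝ] (Fin m → ℝ)) ∘L
            (ContinuousLinearMap.fst ℝ _ _))
      exact hjoint.map Φ
    have hind := HasGaussianLaw.indepFun_of_covariance_eval (X := Y) (Y := fun j ω => R ω j)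
      hjoint' fun i j => by rw [covariance_comm, hRY]
    exact hind.comp measurable_id
      (show Measurable (fun x : Fin m → ℝ => (WithLp.toLp 2 x : Vec m)) by fun_prop)
  · have := hRg.isGaussian_map
    have hRae : AEMeasurable R P := hRg.aemeasurable
    -- A Gaussian law is determined by its mean and covariance.
    apply IsGaussian.ext
    · rw [integral_map hRae (by fun_prop), integral_id_multivariateGaussian']
      ext j
      have hint : Integrable R P := hRg.integrable
      have := (EuclideanSpace.proj (𝕜 := ℝ) j).integral_comp_comm hint
      change _ = (∫ ω, R ω ∂P) j at this
      change (∫ ω, R ω ∂P) j = 0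
      rw [← this]
      change ∫ ω, R ω j ∂P = 0
      rw [ hRj, integral_sub ((hHm j).integrable (by norm_num))
        ((hsm' j).integrable (by norm_num)), integral_add ((hsm j).integrable (by norm_num))
        (integrable_const _), integral_finsetSum _ fun q _ =>
          ((hYm q).const_mul _).integrable (by norm_num)]
      simp [integral_const_mul, hμ, hν]
    · rw [← ContinuousLinearMap.toBilinForm_inj]
      refine LinearMap.BilinForm.ext_basis (EuclideanSpace.basisFun (Fin m) ℝ).toBasis fun i j => ?_
      rw [ContinuousLinearMap.toBilinForm_apply, ContinuousLinearMap.toBilinForm_apply,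
        covarianceBilin_apply_eq_cov, covariance_map, covarianceBilin_multivariateGaussian hS]
      · have h1 (i : Fin m) : (fun u => inner ℝ ((EuclideanSpace.basisFun (Fin m) ℝ).toBasis i) u) ∘
          R = fun ω => R ω i := by ext; simp [PiLp.inner_apply]
        simp_rw [h1, hRR]
        simp
      any_goals exact Measurable.aestronglyMeasurable (by fun_prop)
      · exact hRae
      · exact IsGaussian.memLp_two_id

end Regression

/-! ### The posterior for a fixed design -/

section Posterior

variable {Ω : Type*} [MeasurableSpace Ω] {P : Measure Ω}
  {X : Type*} {m : ℕ} {μ₀ : X → Vec m} {K₀ : X → X → Matrix (Fin m) (Fin m) ℝ} {σ : ℝ}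
  {h : X → Ω → Vec m} {ε : ℕ → Ω → Vec m}

/-- The data set with query points `a` and stacked observations `y`. -/
def stackedData {t : ℕ} (a : Fin t → X) (y : Fin t × Fin m → ℝ) : Data X m t :=
  fun s => (a s, WithLp.toLp 2 fun j => y (s, j))

theorem measurable_stackedData [MeasurableSpace X] {t : ℕ} (a : Fin t → X) :
    Measurable (stackedData (m := m) a) := by
  unfold stackedData
  fun_prop

/-- The stacked noisy observations at the fixed query points `a`. -/
def observation {t : ℕ} (h : X → Ω → Vec m) (ε : ℕ → Ω → Vec m) (a : Fin t → X)
    (p : Fin t × Fin m) (ω : Ω) : ℝ :=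
  h (a p.1) ω p.2 + ε p.1 ω p.2

theorem measurable_postMean_stackedData {t : ℕ} (a : Fin t → X) (z : X) :
    Measurable fun y : Fin t × Fin m → ℝ => postMean μ₀ K₀ σ (stackedData a y) z := by
  -- The matrices depend on the query points only, so evaluating them at zero observations exhibits
  -- an affine function of `y`.
  change Measurable fun y : Fin t × Fin m → ℝ => μ₀ z + WithLp.toLp 2
    ((crossCov K₀ (stackedData a (0 : Fin t × Fin m → ℝ)) z *
      (noisyGram K₀ σ (stackedData a (0 : Fin t × Fin m → ℝ)))⁻¹).mulVec
        fun q => y q - μ₀ (a q.1) q.2)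
  fun_prop

theorem multivariateGaussian_eq_map (μ : Vec m) (S : Matrix (Fin m) (Fin m) ℝ) :
    multivariateGaussian μ S = (multivariateGaussian 0 S).map (fun v => μ + v) := by
  rw [multivariateGaussian, multivariateGaussian, Measure.map_map (by fun_prop) (by fun_prop)]
  congr 1
  ext1 v
  simp

theorem IsGPSample.memLp (hh : IsGPSample P μ₀ K₀ h) (x : X) (j : Fin m) :
    MemLp (fun ω => h x ω j) 2 P :=
  ((hh.gaussian.hasGaussianLaw_eval x).map (EuclideanSpace.proj (𝕜 := ℝ) j)).memLp_two

theorem posSemidef_noiseCov (σ : ℝ) :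
    (σ ^ 2 • (1 : Matrix (Fin m) (Fin m) ℝ)).PosSemidef :=
  Matrix.PosSemidef.one.smul (by positivity)

theorem IsGaussianNoise.hasGaussianLaw (hε : IsGaussianNoise P σ h ε) (t : ℕ) :
    HasGaussianLaw (ε t) P := by
  constructor
  rw [hε.law t]
  infer_instance

theorem IsGaussianNoise.memLp (hε : IsGaussianNoise P σ h ε) (t : ℕ) (j : Fin m) :
    MemLp (fun ω => ε t ω j) 2 P :=
  ((hε.hasGaussianLaw t).map (EuclideanSpace.proj (𝕜 := ℝ) j)).memLp_two

theorem IsGaussianNoise.integral_eq_zero (hε : IsGaussianNoise P σ h ε) (t : ℕ) (j : Fin m) :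
    ∫ ω, ε t ω j ∂P = 0 := by
  have h1 : ∫ ω, ε t ω ∂P = 0 := by
    have := integral_map (μ := P) (hε.measurable t).aemeasurable (f := id) (by fun_prop)
    rw [hε.law t, integral_id_multivariateGaussian'] at this
    simpa using this.symm
  have h2 := (EuclideanSpace.proj (𝕜 := ℝ) j).integral_comp_comm (hε.hasGaussianLaw t).integrable
  rw [h1, map_zero] at h2
  exact h2

theorem IsGaussianNoise.cov (hε : IsGaussianNoise P σ h ε) (s t : ℕ) (j l : Fin m) :
    cov[fun ω => ε s ω j, fun ω => ε t ω l; P] = if s = t ∧ j = l then σ ^ 2 else 0 := by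
  by_cases hst : s = t
  · subst hst
    have h1 := covariance_eval_multivariateGaussian (μ := (0 : Vec m))
      (posSemidef_noiseCov (m := m) σ) j l
    rw [← hε.law s, covariance_map_fun (by fun_prop) (by fun_prop)
      (hε.measurable s).aemeasurable] at h1
    rw [h1]
    simp [Matrix.one_apply]
  · rw [if_neg (fun hc => hst hc.1)]
    refine IndepFun.covariance_eq_zero ?_ (hε.memLp s j) (hε.memLp t l)
    exact (hε.indep.indepFun hst).comp (φ := fun v : Vec m => v j) (ψ := fun v : Vec m => v l)
      (by fun_prop) (by fun_prop)

theorem IsGaussianNoise.cov_sample (hh : IsGPSample P μ₀ K₀ h) (hε : IsGaussianNoise P σ h ε)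
    (x : X) (t : ℕ) (j l : Fin m) : cov[fun ω => h x ω j, fun ω => ε t ω l; P] = 0 := by
  refine IndepFun.covariance_eq_zero ?_ (hh.memLp x j) (hε.memLp t l)
  exact hε.indep_sample.comp (φ := fun v : X → Vec m => v x j) (ψ := fun v : ℕ → Vec m => v t l)
    (by fun_prop) (by fun_prop)

/-- As `X` is finite, the whole sample is a Gaussian vector, independent of the first `t` noise
vectors; the pair in question is a linear image of both. -/
theorem hasGaussianLaw_sample_observation [Fintype X] (hh : IsGPSample P μ₀ K₀ h)
    (hε : IsGaussianNoise P σ h ε) {t : ℕ} (a : Fin t → X) (z : X) :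
    HasGaussianLaw (fun ω => (h z ω, fun q => observation h ε a q ω)) P := by
  have h1 : HasGaussianLaw (fun ω (x : X) => h x ω) P := by
    let Φ : (↥(Finset.univ : Finset X) → Vec m) →L[ℝ] (X → Vec m) :=
      ContinuousLinearMap.pi fun x => ContinuousLinearMap.proj ⟨x, Finset.mem_univ x⟩
    exact (hh.gaussian.hasGaussianLaw Finset.univ).map Φ
  have h2 : HasGaussianLaw (fun ω (s : Fin t) => ε s ω) P :=
    iIndepFun.hasGaussianLaw (fun s => hε.hasGaussianLaw s)
      (hε.indep.precomp Fin.val_injective)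
  have h3 : IndepFun (fun ω (x : X) => h x ω) (fun ω (s : Fin t) => ε s ω) P :=
    hε.indep_sample.comp (φ := id) (ψ := fun (v : ℕ → Vec m) (s : Fin t) => v s) measurable_id (by fun_prop)
  let Φ : ((X → Vec m) × (Fin t → Vec m)) →L[ℝ] (Vec m × (Fin t × Fin m → ℝ)) :=
    ((ContinuousLinearMap.proj (R := ℝ) (φ := fun _ : X => Vec m) z) ∘L (ContinuousLinearMap.fst ℝ _ _)).prod
      (ContinuousLinearMap.pi fun p =>
        (EuclideanSpace.proj (𝕜 := ℝ) p.2) ∘L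
          (((ContinuousLinearMap.proj (R := ℝ) (φ := fun _ : X => Vec m) (a p.1)) ∘L
              (ContinuousLinearMap.fst ℝ _ _)) +
            ((ContinuousLinearMap.proj (R := ℝ) (φ := fun _ : Fin t => Vec m) p.1) ∘L
              (ContinuousLinearMap.snd ℝ _ _))))
  exact (h3.hasGaussianLaw h1 h2).map Φ

variable [IsProbabilityMeasure P]

theorem IsGPSample.posSemidef (hh : IsGPSample P μ₀ K₀ h) {ι : Type*} [Fintype ι] (a : ι → X)
    (b : ι → Fin m) : (Matrix.of fun p q => K₀ (a p) (a q) (b p) (b q)).PosSemidef := by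
  have := posSemidef_covariance (P := P) fun p => hh.memLp (a p) (b p)
  simp_rw [hh.cov] at this
  exact this

theorem IsGPSample.noisyGram_posDef (hh : IsGPSample P μ₀ K₀ h) (hσ : 0 < σ) {t : ℕ}
    (D : Data X m t) : (noisyGram K₀ σ D).PosDef :=
  posDef_add_sq_smul_one (hh.posSemidef (fun p : Fin t × Fin m => (D p.1).1) Prod.snd) hσ

/-- Given the observations at fixed query points `a`, the deviation of `h z` from its posterior mean
is independent of the observations, with the centred Gaussian law of covariance `postCov`. -/
theorem residual_law [Fintype X] (hh : IsGPSample P μ₀ K₀ h) (hε : IsGaussianNoise P σ h ε)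
    (hσ : 0 < σ) {t : ℕ} (a : Fin t → X) (z : X) (y₀ : Fin t × Fin m → ℝ) :
    (postCov K₀ σ (stackedData a y₀) z).PosSemidef ∧
      IndepFun (fun ω p => observation h ε a p ω)
        (fun ω => h z ω - postMean μ₀ K₀ σ (stackedData a fun p => observation h ε a p ω) z) P ∧
      P.map (fun ω => h z ω - postMean μ₀ K₀ σ (stackedData a fun p => observation h ε a p ω) z) =
        multivariateGaussian 0 (postCov K₀ σ (stackedData a y₀) z) := by
  refine gaussian_regression (Y := observation h ε a) (G := noisyGram K₀ σ (stackedData a y₀))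
    (C := crossCov K₀ (stackedData a y₀) z) (K := K₀ z z) (μ := μ₀ z)
    (ν := fun p => μ₀ (a p.1) p.2)
    (hasGaussianLaw_sample_observation hh hε a z)
    ((Matrix.isUnit_iff_isUnit_det _).1 (hh.noisyGram_posDef hσ _).isUnit) ?_ ?_ (hh.cov z z)
    (hh.mean z) ?_ ?_
  · intro p q
    change cov[(fun ω => h (a p.1) ω p.2) + fun ω => ε p.1 ω p.2,
      (fun ω => h (a q.1) ω q.2) + fun ω => ε q.1 ω q.2; P] = _
    rw [covariance_add_left (hh.memLp _ _) (hε.memLp _ _) ((hh.memLp _ _).add (hε.memLp _ _)),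
      covariance_add_right (hh.memLp _ _) (hh.memLp _ _) (hε.memLp _ _),
      covariance_add_right (hε.memLp _ _) (hh.memLp _ _) (hε.memLp _ _),
      hε.cov_sample hh, covariance_comm (fun ω => ε p.1 ω p.2) (fun ω => h (a q.1) ω q.2),
      hε.cov_sample hh, hε.cov, hh.cov]
    simp [noisyGram, stackedData, Matrix.one_apply, Prod.ext_iff, Fin.ext_iff]
  · intro j q
    change cov[fun ω => h z ω j, (fun ω => h (a q.1) ω q.2) + fun ω => ε q.1 ω q.2; P] = _
    rw [covariance_add_right (hh.memLp _ _) (hh.memLp _ _) (hε.memLp _ _), hε.cov_sample hh, hh.cov,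
      add_zero]
    rfl
  · intro q
    unfold observation
    rw [integral_add ((hh.memLp _ _).integrable (by norm_num))
      ((hε.memLp _ _).integrable (by norm_num)), hh.mean, hε.integral_eq_zero, add_zero]
  · intro ω
    rfl

/-- Fubini for the product law, with the slice bound `c` used only over `S`. Retaining the factor `P
(Y ⁻¹' S)` is what later allows summation over designs without loss. -/
theorem measure_mem_and_mem_le_of_indepFun {β γ : Type*} [MeasurableSpace β] [MeasurableSpace γ]
    {Y : Ω → β} {R : Ω → γ} (hY : Measurable Y) (hR : Measurable R) (hind : IndepFun Y R P)
    {B : Set (β × γ)} (hB : MeasurableSet B) {S : Set β} (hS : MeasurableSet S) {c : ENNReal}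
    (hc : ∀ y, P.map R (Prod.mk y ⁻¹' B) ≤ c) :
    P {ω | Y ω ∈ S ∧ (Y ω, R ω) ∈ B} ≤ c * P (Y ⁻¹' S) := by
  have := Measure.isProbabilityMeasure_map (μ := P) hY.aemeasurable
  have := Measure.isProbabilityMeasure_map (μ := P) hR.aemeasurable
  have hprod := (indepFun_iff_map_prod_eq_prod_map_map hY.aemeasurable hR.aemeasurable).1 hind
  have hSB : MeasurableSet (Prod.fst ⁻¹' S ∩ B) := (measurable_fst hS).inter hB
  calc P {ω | Y ω ∈ S ∧ (Y ω, R ω) ∈ B}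
      = P.map (fun ω => (Y ω, R ω)) (Prod.fst ⁻¹' S ∩ B) := by
        rw [Measure.map_apply (hY.prodMk hR) hSB]; rfl
    _ = ∫⁻ y, P.map R (Prod.mk y ⁻¹' (Prod.fst ⁻¹' S ∩ B)) ∂(P.map Y) := by
        rw [hprod, Measure.prod_apply hSB]
    _ ≤ ∫⁻ y, S.indicator (fun _ => c) y ∂(P.map Y) := lintegral_mono fun y => by
        by_cases hy : y ∈ S
        · rw [Set.indicator_of_mem hy]
          exact (measure_mono fun r hr => hr.2).trans (hc y)
        · rw [Set.indicator_of_notMem hy]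
          refine le_of_eq (measure_mono_null (t := ∅) (fun r hr => hy hr.1) measure_empty)
    _ = c * P (Y ⁻¹' S) := by
        rw [lintegral_indicator_const hS, Measure.map_apply hY hS]

end Posterior

/-! ### From fixed to adaptive designs -/

section AdaptiveDesign

variable {X : Type*} {m : ℕ} {rule : (t : ℕ) → Data X m t → X}

/-- The data sets all of whose query points were chosen by the rule. -/
def consistentData (rule : (t : ℕ) → Data X m t → X) (t : ℕ) : Set (Data X m t) :=
  {d | ∀ s : Fin t, (d s).1 = rule s fun r => d (Fin.castLE s.2.le r)}

theorem dataset_castLE (f : X → Vec m) (e : ℕ → Vec m) {s t : ℕ} (hst : s ≤ t) :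
    (fun r => dataset rule f e t (Fin.castLE hst r)) = dataset rule f e s := by
  induction t, hst using Nat.le_induction with
  | base => rfl
  | succ t hst ih =>
    rw [← ih]
    ext1 r
    exact Fin.snoc_castSucc (α := fun _ => X × Vec m) _ _ (Fin.castLE hst r)

theorem dataset_apply (f : X → Vec m) (e : ℕ → Vec m) {t : ℕ} (s : Fin t) :
    dataset rule f e t s = (query rule f e s, f (query rule f e s) + e s) := by
  have h1 := congrFun (dataset_castLE (rule := rule) f e (Nat.succ_le_of_lt s.2)) (Fin.last s)
  have h2 : Fin.castLE (Nat.succ_le_of_lt s.2) (Fin.last s) = s := rfl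
  rw [h2] at h1
  rw [h1]
  exact Fin.snoc_last (α := fun _ => X × Vec m) _ _

theorem dataset_mem_consistentData (f : X → Vec m) (e : ℕ → Vec m) (t : ℕ) :
    dataset rule f e t ∈ consistentData rule t := by
  intro s
  rw [dataset_apply, dataset_castLE]
  rfl

variable {Ω : Type*} {h : X → Ω → Vec m} {ε : ℕ → Ω → Vec m}

theorem dataset_eq_stackedData (ω : Ω) (t : ℕ) :
    dataset rule (fun x => h x ω) (fun s => ε s ω) t =
      stackedData (fun s => query rule (fun x => h x ω) (fun s => ε s ω) s)
        fun p => observation h ε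
          (fun s : Fin t => query rule (fun x => h x ω) (fun s => ε s ω) s) p ω := by
  ext1 s
  rw [dataset_apply]
  rfl

/-- By strong induction: designs that agree so far yield the same observations at `ω`, so the rule
picks the same next point. -/
theorem eq_of_mem_consistentData {t : ℕ} {a b : Fin t → X} {ω : Ω}
    (ha : stackedData a (fun p => observation h ε a p ω) ∈ consistentData rule t)
    (hb : stackedData b (fun p => observation h ε b p ω) ∈ consistentData rule t) : a = b := by
  have key : ∀ n (hn : n < t), a ⟨n, hn⟩ = b ⟨n, hn⟩ := by
    intro n
    induction n using Nat.strong_induction_on with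
    | _ n ih =>
      intro hn
      have h1 := ha ⟨n, hn⟩
      have h2 := hb ⟨n, hn⟩
      refine h1.trans (Eq.trans ?_ h2.symm)
      congr 1
      ext1 r
      have h3 : a (Fin.castLE hn.le r) = b (Fin.castLE hn.le r) := ih r r.2 (r.2.trans hn)
      simp [stackedData, observation, h3]
  ext ⟨n, hn⟩
  exact key n hn

variable [MeasurableSpace Ω] {P : Measure Ω} [IsProbabilityMeasure P]
  {μ₀ : X → Vec m} {K₀ : X → X → Matrix (Fin m) (Fin m) ℝ} {σ : ℝ}

/-- A property of the data and of `h z` whose posterior probability is at most `c` has probability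
at most `c` for the data collected by an adaptive rule. -/
theorem measure_dataset_le [Fintype X] [MeasurableSpace X] [DiscreteMeasurableSpace X]
    (hh : IsGPSample P μ₀ K₀ h) (hε : IsGaussianNoise P σ h ε) (hσ : 0 < σ)
    (hrule : ∀ t, Measurable (rule t)) (t : ℕ) (z : X) (Bad : Data X m t → Vec m → Prop)
    (hmeas : ∀ a : Fin t → X, MeasurableSet
      {p : (Fin t × Fin m → ℝ) × Vec m | Bad (stackedData a p.1) p.2})
    {c : ENNReal} (hc : ∀ D : Data X m t,
      multivariateGaussian (postMean μ₀ K₀ σ D z) (postCov K₀ σ D z) {v | Bad D v} ≤ c) :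
    P {ω | Bad (dataset rule (fun x => h x ω) (fun s => ε s ω) t) (h z ω)} ≤ c := by
  classical
  let Y : (Fin t → X) → Ω → Fin t × Fin m → ℝ := fun a ω p => observation h ε a p ω
  have hYm : ∀ a, Measurable (Y a) := fun a => by
    have h1 := hh.measurable
    have h2 := hε.measurable
    unfold Y observation
    fun_prop
  -- Observations under which the rule itself would have followed `a`; a condition on `Y a` alone,
  -- which is what makes independence of the residual usable.
  let S : (Fin t → X) → Set (Fin t × Fin m → ℝ) := fun a => stackedData a ⁻¹' consistentData rule t
  have hSm : ∀ a, MeasurableSet (S a) := fun a => by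
    have : S a = ⋂ s : Fin t, {y | a s = rule s fun r => stackedData a y (Fin.castLE s.2.le r)} := by
      ext y
      simp [S, consistentData, stackedData]
    rw [this]
    refine MeasurableSet.iInter fun s => ?_
    have h1 : Measurable fun y : Fin t × Fin m → ℝ =>
        rule s fun r => stackedData a y (Fin.castLE s.2.le r) := by
      refine (hrule s).comp (measurable_pi_lambda _ fun r => ?_)
      exact (measurable_pi_apply _).comp (measurable_stackedData a)
    exact measurableSet_eq_fun measurable_const h1
  have hstep : ∀ a : Fin t → X,
      P {ω | Y a ω ∈ S a ∧ Bad (stackedData a (Y a ω)) (h z ω)} ≤ c * P (Y a ⁻¹' S a) := by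
    intro a
    obtain ⟨-, hind, hlaw⟩ := residual_law hh hε hσ a z (0 : Fin t × Fin m → ℝ)
    let B : Set ((Fin t × Fin m → ℝ) × Vec m) :=
      {p | Bad (stackedData a p.1) (postMean μ₀ K₀ σ (stackedData a p.1) z + p.2)}
    have hBm : MeasurableSet B := by
      have : Measurable fun p : (Fin t × Fin m → ℝ) × Vec m =>
          (p.1, postMean μ₀ K₀ σ (stackedData a p.1) z + p.2) :=
        measurable_fst.prodMk (((measurable_postMean_stackedData a z).comp measurable_fst).add measurable_snd)
      exact this (hmeas a)
    have h1 := measure_mem_and_mem_le_of_indepFun (c := c) (hYm a)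
      ((hh.measurable z).sub ((measurable_postMean_stackedData a z).comp (hYm a))) hind hBm (hSm a) fun y => ?_
    · refine le_trans (measure_mono fun ω hω => ?_) h1
      refine ⟨hω.1, ?_⟩
      change Bad _ (postMean μ₀ K₀ σ (stackedData a (Y a ω)) z +
        (h z ω - postMean μ₀ K₀ σ (stackedData a (Y a ω)) z))
      rw [add_sub_cancel]
      exact hω.2
    · have h2 := hc (stackedData a y)
      rw [multivariateGaussian_eq_map, Measure.map_apply (by fun_prop)] at h2
      · exact (congrArg (fun ν : Measure (Vec m) => ν (Prod.mk y ⁻¹' B)) hlaw).le.trans h2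
      · exact measurable_prodMk_left (x := y) (hmeas a)
  calc P {ω | Bad (dataset rule (fun x => h x ω) (fun s => ε s ω) t) (h z ω)}
      ≤ P (⋃ a, {ω | Y a ω ∈ S a ∧ Bad (stackedData a (Y a ω)) (h z ω)}) :=
        measure_mono fun ω hω => by
          rw [Set.mem_iUnion]
          refine ⟨fun s => query rule (fun x => h x ω) (fun s => ε s ω) s, ?_, ?_⟩
          · have := dataset_mem_consistentData (rule := rule) (fun x => h x ω) (fun s => ε s ω) t
            rw [dataset_eq_stackedData] at this
            exact this
          · have : Bad _ _ := hω
            rw [dataset_eq_stackedData] at this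
            exact this
    _ ≤ ∑ a, P {ω | Y a ω ∈ S a ∧ Bad (stackedData a (Y a ω)) (h z ω)} :=
        measure_iUnion_fintype_le _ _
    _ ≤ ∑ a, c * P (Y a ⁻¹' S a) := Finset.sum_le_sum fun a _ => hstep a
    -- Different designs are never consistent at the same `ω`, so their probabilities add up to at
    -- most one.
    _ = c * P (⋃ a, Y a ⁻¹' S a) := by
        rw [← Finset.mul_sum, measure_iUnion _ fun a => hYm a (hSm a), tsum_fintype]
        intro a b hab
        exact Set.disjoint_left.2 fun ω ha hb => hab (eq_of_mem_consistentData ha hb)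
    _ ≤ c := mul_le_of_le_one_right' prob_le_one

end AdaptiveDesign

/-! ### The levels and `β` -/

section Constants

variable {X : Type*} [Fintype X] [Nonempty X] {m n : ℕ} {δ : ℝ}

theorem level_pos (hδ : 0 < δ) (t : ℕ) : 0 < level X n δ t := by
  have : 0 < (Fintype.card X : ℝ) := by exact_mod_cast Fintype.card_pos
  unfold level
  positivity

theorem level_lt_one (hδ0 : 0 < δ) (hδ : δ < 1) (t : ℕ) : level X n δ t < 1 := by
  have hc : 1 ≤ (Fintype.card X : ℝ) := by exact_mod_cast Fintype.card_pos
  have hpi : 9 < Real.pi ^ 2 := by nlinarith [Real.pi_gt_three]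
  have h1 : (1 : ℝ) ≤ ((t : ℝ) + 1) ^ 2 := one_le_pow₀ (by linarith [Nat.cast_nonneg (α := ℝ) t])
  have h2 : (1 : ℝ) ≤ (n : ℝ) + 1 := by linarith [Nat.cast_nonneg (α := ℝ) n]
  unfold level
  rw [div_lt_one (by positivity)]
  calc 6 * δ < 9 * 1 * 1 * 1 := by linarith
    _ ≤ Real.pi ^ 2 * (t + 1) ^ 2 * (n + 1) * Fintype.card X := by gcongr

theorem one_le_beta_arg (hm : 0 < m) (hδ0 : 0 < δ) (hδ : δ < 1) :
    1 ≤ m * Real.pi ^ 2 * (n + 1) * Fintype.card X / (3 * δ) := by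
  have hc : 1 ≤ (Fintype.card X : ℝ) := by exact_mod_cast Fintype.card_pos
  have hm' : 1 ≤ (m : ℝ) := by exact_mod_cast hm
  have hpi : 9 < Real.pi ^ 2 := by nlinarith [Real.pi_gt_three]
  have h2 : (1 : ℝ) ≤ (n : ℝ) + 1 := by linarith [Nat.cast_nonneg (α := ℝ) n]
  rw [one_le_div (by positivity)]
  calc 3 * δ ≤ 1 * 9 * 1 * 1 := by linarith
    _ ≤ m * Real.pi ^ 2 * (n + 1) * Fintype.card X := by gcongr

theorem beta_eq (hm : 0 < m) (hδ0 : 0 < δ) (hδ : δ < 1) {t : ℕ} (ht : 1 ≤ t) :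
    beta X m n δ t =
      2 * (Real.log (m * Real.pi ^ 2 * (n + 1) * Fintype.card X / (3 * δ)) + 2 * Real.log t) := by
  have h1 := one_le_beta_arg (X := X) (n := n) hm hδ0 hδ
  have ht' : (0 : ℝ) < t := by exact_mod_cast ht
  have : (m * Real.pi ^ 2 * t ^ 2 * (n + 1) * Fintype.card X / (3 * δ) : ℝ) =
      (m * Real.pi ^ 2 * (n + 1) * Fintype.card X / (3 * δ)) * t ^ 2 := by ring
  rw [beta, this, Real.log_mul (by positivity) (by positivity), Real.log_pow]
  norm_num

theorem beta_nonneg (hm : 0 < m) (hδ0 : 0 < δ) (hδ : δ < 1) {t : ℕ} (ht : 1 ≤ t) :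
    0 ≤ beta X m n δ t := by
  rw [beta_eq hm hδ0 hδ ht]
  have h1 := Real.log_nonneg (one_le_beta_arg (X := X) (n := n) hm hδ0 hδ)
  have h2 := Real.log_nonneg (x := t) (by exact_mod_cast ht)
  positivity

theorem beta_mono (hm : 0 < m) (hδ0 : 0 < δ) (hδ : δ < 1) {s t : ℕ} (hs : 1 ≤ s) (hst : s ≤ t) :
    beta X m n δ s ≤ beta X m n δ t := by
  have hs' : (0 : ℝ) < s := by exact_mod_cast hs
  rw [beta_eq hm hδ0 hδ hs, beta_eq hm hδ0 hδ (hs.trans hst)]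
  gcongr

/-- Calibration of `β`: the `m` coordinate tails together cost half a level. With `t` data points
the index is `t + 1`, matching the `(t + 1)²` in the level. -/
theorem mul_exp_neg_beta (hm : 0 < m) (hδ0 : 0 < δ) (t : ℕ) :
    m * Real.exp (-beta X m n δ (t + 1) / 2) = level X n δ t / 2 := by
  have hc : 0 < (Fintype.card X : ℝ) := by exact_mod_cast Fintype.card_pos
  have hm' : 0 < (m : ℝ) := by exact_mod_cast hm
  rw [beta, neg_div, mul_div_cancel_left₀ _ (by norm_num), Real.exp_neg,
    Real.exp_log (by positivity), level]
  push_cast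
  field_simp
  norm_num

theorem hasSum_level (hδ0 : 0 < δ) :
    HasSum (fun t => Fintype.card X * ((n + 1) * level X n δ t)) δ := by
  have hc : 0 < (Fintype.card X : ℝ) := by exact_mod_cast Fintype.card_pos
  -- The Basel sum without its index-zero term, which is `1 / 0 = 0`.
  have h1 := (hasSum_nat_add_iff' (f := fun n : ℕ => 1 / (n : ℝ) ^ 2) 1).2 hasSum_zeta_two
  simp only [Finset.sum_range_one, Nat.cast_zero, ne_eq, OfNat.ofNat_ne_zero, not_false_eq_true,
    zero_pow, div_zero, sub_zero] at h1
  convert! h1.mul_left (6 * δ / Real.pi ^ 2) using 1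
  · ext t
    rw [level]
    push_cast
    field_simp
  · field_simp

end Constants

/-! ### Asymptotic rates -/

section SoftO

variable {X : Type*} [Fintype X] [Nonempty X] {m n : ℕ} {δ : ℝ}
  {K₀ : X → X → Matrix (Fin m) (Fin m) ℝ} {σ : ℝ}

/-- With `A` the constant logarithm in `beta_eq`, `β = 2A + 4 log T ≤ 6 log T ≤ 9 (log T)²` once
`log T ≥ max A 1`. -/
theorem eventually_sqrt_beta_le (hm : 0 < m) (hδ0 : 0 < δ) (hδ : δ < 1) :
    ∀ᶠ T : ℕ in atTop, Real.sqrt (beta X m n δ T) ≤ 3 * Real.log T := by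
  have hlog : Tendsto (fun T : ℕ => Real.log T) atTop atTop :=
    Real.tendsto_log_atTop.comp tendsto_natCast_atTop_atTop
  filter_upwards [eventually_ge_atTop 1, hlog.eventually_ge_atTop 1, hlog.eventually_ge_atTop
    (Real.log (m * Real.pi ^ 2 * (n + 1) * Fintype.card X / (3 * δ)))] with T hT h1 hA
  rw [Real.sqrt_le_left (by linarith), beta_eq hm hδ0 hδ hT]
  nlinarith

/-- One power of the logarithm absorbs `√β`. The weight `w` is left general to cover both `T + 2`
and `(2σ² + κ) T`. -/
theorem isSoftO_sqrt_beta_mul (hm : 0 < m) (hδ0 : 0 < δ) (hδ : δ < 1)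
    (hγ : ∀ j t, 0 ≤ maxInfoGain K₀ σ j t) (C c : ℝ) (hc : 0 ≤ c) {w : ℕ → ℝ}
    (hw : ∀ T : ℕ, 1 ≤ T → w T ≤ c * T) :
    IsSoftO (fun T => C * Real.sqrt (beta X m n δ T) *
        ∑ j, Real.sqrt (w T * maxInfoGain K₀ σ j T))
      (fun T => Real.sqrt (maxInfoGainMax K₀ σ T * T)) := by
  refine ⟨1, Asymptotics.IsBigO.of_bound (|C| * 3 * (m * Real.sqrt c)) ?_⟩
  filter_upwards [eventually_sqrt_beta_le (X := X) (n := n) hm hδ0 hδ, eventually_ge_atTop 1] with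
    T hβ hT
  have hlog : 0 ≤ Real.log T := Real.log_nonneg (by exact_mod_cast hT)
  have hsum : ∑ j, Real.sqrt (w T * maxInfoGain K₀ σ j T) ≤
      m * Real.sqrt c * Real.sqrt (maxInfoGainMax K₀ σ T * T) := by
    calc _ ≤ ∑ _j : Fin m, Real.sqrt (c * (maxInfoGainMax K₀ σ T * T)) := by
          refine Finset.sum_le_sum fun j _ => Real.sqrt_le_sqrt ?_
          have h1 : maxInfoGain K₀ σ j T ≤ maxInfoGainMax K₀ σ T :=
            le_ciSup (f := fun j => maxInfoGain K₀ σ j T) (Set.finite_range _).bddAbove j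
          calc w T * maxInfoGain K₀ σ j T ≤ (c * T) * maxInfoGainMax K₀ σ T :=
                mul_le_mul (hw T hT) h1 (hγ j T) (by positivity)
            _ = _ := by ring
      _ = _ := by rw [Real.sqrt_mul hc]; simp [mul_assoc]
  have hs0 : 0 ≤ ∑ j, Real.sqrt (w T * maxInfoGain K₀ σ j T) :=
    Finset.sum_nonneg fun _ _ => Real.sqrt_nonneg _
  rw [Real.norm_eq_abs, Real.norm_eq_abs, abs_mul, abs_mul, abs_of_nonneg (Real.sqrt_nonneg _),
    abs_of_nonneg hs0, pow_one, abs_of_nonneg (mul_nonneg (Real.sqrt_nonneg _) hlog)]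
  calc _ ≤ |C| * (3 * Real.log T) *
        (m * Real.sqrt c * Real.sqrt (maxInfoGainMax K₀ σ T * T)) := by gcongr
    _ = _ := by ring

end SoftO

/-! ### Lipschitz functions and the optimal value -/

section Performance

theorem lipschitz_const_nonneg {m : ℕ} (hm : 0 < m) {φ : Vec m → ℝ} {ℓ : ℝ}
    (hφ : ∀ y z, |φ y - φ z| ≤ ℓ * ∑ j, |y j - z j|) : 0 ≤ ℓ := by
  have h1 := (abs_nonneg _).trans (hφ (WithLp.toLp 2 fun _ => 1) 0)
  have h2 : (0 : ℝ) < m := by exact_mod_cast hm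
  simp only [PiLp.zero_apply, sub_zero, abs_one, Finset.sum_const, Finset.card_univ,
    Fintype.card_fin, nsmul_eq_mul, mul_one] at h1
  exact nonneg_of_mul_nonneg_left h1 h2

theorem measurable_of_lipschitz {m : ℕ} {φ : Vec m → ℝ} {ℓ : ℝ}
    (hφ : ∀ y z, |φ y - φ z| ≤ ℓ * ∑ j, |y j - z j|) : Measurable φ := by
  refine Continuous.measurable (continuous_iff_continuousAt.2 fun z => ?_)
  rw [ContinuousAt, tendsto_iff_dist_tendsto_zero]
  refine squeeze_zero (fun _ => dist_nonneg) (fun y => hφ y z) ?_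
  have : Continuous fun y : Vec m => ℓ * ∑ j, |y j - z j| := by fun_prop
  simpa using this.tendsto z

variable {X : Type*} {m n : ℕ}

theorem isProbabilityMeasure_predLaw {μ₀ : X → Vec m}
    {K₀ : X → X → Matrix (Fin m) (Fin m) ℝ} {σ : ℝ} {g : Fin (n + 1) → X → Vec m → ℝ}
    {L : Fin (n + 1) → ℝ} (hL : ∀ i x y z, |g i x y - g i x z| ≤ L i * ∑ j, |y j - z j|)
    {t : ℕ} (i : Fin (n + 1)) (D : Data X m t) (z : X) :
    IsProbabilityMeasure (predLaw μ₀ K₀ σ g i D z) :=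
  Measure.isProbabilityMeasure_map (measurable_of_lipschitz (hL i z)).aemeasurable

theorem cumRegret_le_cumPosRegret (g : Fin (n + 1) → X → Vec m → ℝ) (f : X → Vec m) (x : ℕ → X)
    (T : ℕ) : cumRegret g f x T ≤ cumPosRegret g f x T :=
  Finset.sum_le_sum fun _ _ => le_max_left _ _

theorem optValue_mem [Finite X] {g : Fin (n + 1) → X → Vec m → ℝ} {f : X → Vec m}
    (hf : (feasibleSet g f).Nonempty) : ∃ x ∈ feasibleSet g f, g 0 x (f x) = optValue g f :=
  (hf.image _).csSup_mem (Set.toFinite _)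

end Performance

/-! ### Widths and the confidence event -/

section Confidence

variable {Ω : Type*} [MeasurableSpace Ω] {P : Measure Ω} [IsProbabilityMeasure P]
  {X : Type*} [Fintype X] {m n : ℕ}
  {μ₀ : X → Vec m} {K₀ : X → X → Matrix (Fin m) (Fin m) ℝ} {σ δ : ℝ}
  {g : Fin (n + 1) → X → Vec m → ℝ} {L : Fin (n + 1) → ℝ}
  {h : X → Ω → Vec m} {ε : ℕ → Ω → Vec m}

/-- The matrix depends only on the query points, so it is the residual covariance of the fixed
design they form. -/
theorem postCov_posSemidef (hh : IsGPSample P μ₀ K₀ h) (hε : IsGaussianNoise P σ h ε)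
    (hσ : 0 < σ) {t : ℕ} (D : Data X m t) (z : X) : (postCov K₀ σ D z).PosSemidef :=
  (residual_law hh hε hσ (fun s => (D s).1) z fun p => (D p.1).2 p.2).1

theorem scalarPostVar_nonneg (hh : IsGPSample P μ₀ K₀ h) (hε : IsGaussianNoise P σ h ε)
    (hσ : 0 < σ) {t : ℕ} (a : Fin t → X) (z : X) (j : Fin m) :
    0 ≤ scalarPostVar (fun x y => K₀ x y j j) σ a z := by
  let D : Data X m t := stackedData a 0
  exact (postCov_posSemidef hh hε hσ D z).diag_nonneg.trans
    (postCov_le_scalarPostVar (fun j t a => hh.posSemidef a fun _ => j) hσ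
      (hh.noisyGram_posDef hσ D) z j)

theorem maxInfoGain_nonneg [Nonempty X] (hh : IsGPSample P μ₀ K₀ h)
    (hε : IsGaussianNoise P σ h ε) (hσ : 0 < σ) (j : Fin m) (t : ℕ) :
    0 ≤ maxInfoGain K₀ σ j t := by
  obtain ⟨z⟩ := ‹Nonempty X›
  have h1 := sum_log_scalarPostVar (K₀ := K₀) (fun j t a => hh.posSemidef a fun _ => j) hσ j
    (fun _ => z) t fun t => scalarPostVar_nonneg hh hε hσ _ _ _
  have h2 : 0 ≤ 2 * infoGain K₀ σ j (fun _ : Fin t => z) := by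
    rw [← h1]
    refine Finset.sum_nonneg fun s _ => Real.log_nonneg ?_
    have := scalarPostVar_nonneg hh hε hσ (fun _ : Fin s => z) z j
    have : 0 ≤ scalarPostVar (fun x y => K₀ x y j j) σ (fun _ : Fin s => z) z / σ ^ 2 := by
      positivity
    linarith
  have h3 := infoGain_le_maxInfoGain (K₀ := K₀) (σ := σ) j (fun _ : Fin t => z)
  linarith

/-- Cauchy–Schwarz over time for each output, then comparison with the scalar posterior variances
along the realized query path. The bound is deterministic, for any rule and any path. -/
theorem sum_sqrt_postCov_le (hh : IsGPSample P μ₀ K₀ h) (hε : IsGaussianNoise P σ h ε)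
    (hσ : 0 < σ) (rule : (t : ℕ) → Data X m t → X) (f : X → Vec m) (e : ℕ → Vec m)
    {κ : ℝ} (hκ : ∀ j z, K₀ z z j j ≤ κ) (T : ℕ) :
    ∑ t ∈ Finset.range T, ∑ j,
        Real.sqrt (postCov K₀ σ (dataset rule f e t) (query rule f e t) j j) ≤
      ∑ j, Real.sqrt ((2 * σ ^ 2 + κ) * T * maxInfoGain K₀ σ j T) := by
  have hK : ∀ (j : Fin m) (t : ℕ) (a : Fin t → X),
      (Matrix.of fun p q => K₀ (a p) (a q) j j).PosSemidef :=
    fun j t a => hh.posSemidef a fun _ => j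
  rw [Finset.sum_comm]
  refine Finset.sum_le_sum fun j _ => Real.le_sqrt_of_sq_le ?_
  refine sq_sum_le_card_mul_sum_sq.trans ?_
  rw [Finset.card_range, mul_assoc, mul_left_comm]
  refine mul_le_mul_of_nonneg_left ?_ (Nat.cast_nonneg _)
  refine le_trans (Finset.sum_le_sum fun t _ => ?_)
    (sum_scalarPostVar_le hK hσ j (query rule f e) T
      (fun t => scalarPostVar_nonneg hh hε hσ _ _ _) (hκ j))
  rw [Real.sq_sqrt (postCov_posSemidef hh hε hσ _ _).diag_nonneg]
  refine (postCov_le_scalarPostVar hK hσ (hh.noisyGram_posDef hσ _) _ j).trans_eq ?_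
  simp_rw [dataset_apply]

variable [Nonempty X]

theorem measure_sum_abs_sub_postMean_gt_le (hm : 0 < m) (hδ0 : 0 < δ) (hδ : δ < 1)
    (hh : IsGPSample P μ₀ K₀ h) (hε : IsGaussianNoise P σ h ε) (hσ : 0 < σ) {t : ℕ}
    (D : Data X m t) (z : X) :
    multivariateGaussian (postMean μ₀ K₀ σ D z) (postCov K₀ σ D z)
      {v | Real.sqrt (beta X m n δ (t + 1)) * ∑ j, Real.sqrt (postCov K₀ σ D z j j) <
        ∑ j, |v j - postMean μ₀ K₀ σ D z j|} ≤ ENNReal.ofReal (level X n δ t / 2) := by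
  refine (multivariateGaussian_sum_abs_sub_gt_le _ (postCov_posSemidef hh hε hσ D z)
    (Real.sqrt_nonneg _)).trans_eq ?_
  rw [Real.sq_sqrt (beta_nonneg hm hδ0 hδ (by omega)), ← mul_exp_neg_beta hm hδ0,
    ENNReal.ofReal_mul (by positivity), ENNReal.ofReal_natCast]

theorem measure_upper_lt_le (hδ0 : 0 < δ) (hδ : δ < 1)
    (hL : ∀ i x y z, |g i x y - g i x z| ≤ L i * ∑ j, |y j - z j|) {t : ℕ}
    (i : Fin (n + 1)) (D : Data X m t) (z : X) :
    multivariateGaussian (postMean μ₀ K₀ σ D z) (postCov K₀ σ D z)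
      {v | upper μ₀ K₀ σ δ g i D z < g i z v} ≤ ENNReal.ofReal (level X n δ t / 2) := by
  have := isProbabilityMeasure_predLaw (μ₀ := μ₀) (K₀ := K₀) (σ := σ) hL i D z
  have h0 := level_pos (X := X) (n := n) hδ0 t
  have h1 := level_lt_one (X := X) (n := n) hδ0 hδ t
  have h2 := measure_quantile_lt_le (predLaw μ₀ K₀ σ g i D z) (p := 1 - level X n δ t / 2)
    (by linarith) (by linarith)
  rw [sub_sub_cancel] at h2
  refine le_trans (le_of_eq ?_) h2
  rw [predLaw, Measure.map_apply (measurable_of_lipschitz (hL i z)) measurableSet_Ioi]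
  rfl

/-- The posterior law gives an ℓ¹ ball around its mean mass at least `1 - α_t / 2`, and `g i z` is
Lipschitz there; hence the quantile at that level cannot be larger. -/
theorem upper_le (hm : 0 < m) (hδ0 : 0 < δ) (hδ : δ < 1)
    (hL : ∀ i x y z, |g i x y - g i x z| ≤ L i * ∑ j, |y j - z j|)
    (hh : IsGPSample P μ₀ K₀ h) (hε : IsGaussianNoise P σ h ε) (hσ : 0 < σ) {t : ℕ}
    (i : Fin (n + 1)) (D : Data X m t) (z : X) :
    upper μ₀ K₀ σ δ g i D z ≤ g i z (postMean μ₀ K₀ σ D z) +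
      L i * (Real.sqrt (beta X m n δ (t + 1)) * ∑ j, Real.sqrt (postCov K₀ σ D z j j)) := by
  have := isProbabilityMeasure_predLaw (μ₀ := μ₀) (K₀ := K₀) (σ := σ) hL i D z
  have h0 := level_pos (X := X) (n := n) hδ0 t
  have h1 := level_lt_one (X := X) (n := n) hδ0 hδ t
  have hL0 : 0 ≤ L i := lipschitz_const_nonneg hm (hL i z)
  rw [upper, quantile_le_iff _ (by linarith) (by linarith)]
  set b := Real.sqrt (beta X m n δ (t + 1)) * ∑ j, Real.sqrt (postCov K₀ σ D z j j)
  have h2 : predLaw μ₀ K₀ σ g i D z (Set.Iic (g i z (postMean μ₀ K₀ σ D z) + L i * b))ᶜ ≤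
      ENNReal.ofReal (level X n δ t / 2) := by
    refine le_trans ?_ (measure_sum_abs_sub_postMean_gt_le hm hδ0 hδ hh hε hσ D z)
    rw [predLaw, Measure.map_apply (measurable_of_lipschitz (hL i z)) measurableSet_Iic.compl]
    refine measure_mono fun v hv => ?_
    rw [Set.mem_ofPred]
    by_contra hcon
    refine hv ?_
    rw [Set.mem_Iic]
    have h3 := (le_abs_self _).trans (hL i z v (postMean μ₀ K₀ σ D z))
    have h4 := mul_le_mul_of_nonneg_left (not_lt.1 hcon) hL0
    change _ ≤ _ + L i * (Real.sqrt (beta X m n δ (t + 1)) * _)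
    linarith
  have h3 := ENNReal.toReal_mono ENNReal.ofReal_ne_top h2
  rw [ENNReal.toReal_ofReal (by linarith), ← measureReal_def,
    probReal_compl_eq_one_sub measurableSet_Iic] at h3
  linarith

/-- By `quantile_le_iff`, a sublevel set of the quantile is a condition on the Gaussian measure of a
section. The posterior covariance does not vary with `y`, so that measure is a measurable function
of `y`. -/
theorem measurable_upper_stackedData (hδ0 : 0 < δ) (hδ : δ < 1)
    (hL : ∀ i x y z, |g i x y - g i x z| ≤ L i * ∑ j, |y j - z j|) {t : ℕ}
    (i : Fin (n + 1)) (a : Fin t → X) (z : X) :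
    Measurable fun y : Fin t × Fin m → ℝ => upper μ₀ K₀ σ δ g i (stackedData a y) z := by
  have h0 := level_pos (X := X) (n := n) hδ0 t
  have h1 := level_lt_one (X := X) (n := n) hδ0 hδ t
  have hg := measurable_of_lipschitz (hL i z)
  refine measurable_of_Iic fun v => ?_
  set S := postCov K₀ σ (stackedData a (0 : Fin t × Fin m → ℝ)) z
  let A : Set ((Fin t × Fin m → ℝ) × Vec m) :=
    {p | g i z (postMean μ₀ K₀ σ (stackedData a p.1) z + p.2) ≤ v}
  have hA : MeasurableSet A := measurableSet_le
    (hg.comp (((measurable_postMean_stackedData a z).comp measurable_fst).add measurable_snd))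
    measurable_const
  have hset : (fun y : Fin t × Fin m → ℝ => upper μ₀ K₀ σ δ g i (stackedData a y) z) ⁻¹' Set.Iic v =
      {y | 1 - level X n δ t / 2 ≤ (multivariateGaussian 0 S (Prod.mk y ⁻¹' A)).toReal} := by
    ext y
    have := isProbabilityMeasure_predLaw (μ₀ := μ₀) (K₀ := K₀) (σ := σ) hL i (stackedData a y) z
    rw [Set.mem_preimage, Set.mem_Iic, upper, quantile_le_iff _ (by linarith) (by linarith),
      Set.mem_ofPred, measureReal_def, predLaw, Measure.map_apply hg measurableSet_Iic,
      multivariateGaussian_eq_map, Measure.map_apply (by fun_prop) (hg measurableSet_Iic)]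
    rfl
  rw [hset]
  exact measurableSet_le measurable_const (measurable_measure_prodMk_left hA).ennreal_toReal

variable [MeasurableSpace X] [DiscreteMeasurableSpace X] {rule : (t : ℕ) → Data X m t → X}

theorem measure_dataset_upper_lt_le (hδ0 : 0 < δ) (hδ : δ < 1)
    (hL : ∀ i x y z, |g i x y - g i x z| ≤ L i * ∑ j, |y j - z j|)
    (hh : IsGPSample P μ₀ K₀ h) (hε : IsGaussianNoise P σ h ε) (hσ : 0 < σ)
    (hrule : ∀ t, Measurable (rule t)) (t : ℕ) (z : X) (i : Fin (n + 1)) :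
    P {ω | upper μ₀ K₀ σ δ g i (dataset rule (fun x => h x ω) (fun s => ε s ω) t) z <
      g i z (h z ω)} ≤ ENNReal.ofReal (level X n δ t / 2) :=
  measure_dataset_le hh hε hσ hrule t z (fun D v => upper μ₀ K₀ σ δ g i D z < g i z v)
    (fun a => measurableSet_lt ((measurable_upper_stackedData hδ0 hδ hL i a z).comp measurable_fst)
      ((measurable_of_lipschitz (hL i z)).comp measurable_snd))
    fun D => measure_upper_lt_le hδ0 hδ hL i D z

theorem measure_dataset_sum_abs_gt_le (hm : 0 < m) (hδ0 : 0 < δ) (hδ : δ < 1)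
    (hh : IsGPSample P μ₀ K₀ h) (hε : IsGaussianNoise P σ h ε) (hσ : 0 < σ)
    (hrule : ∀ t, Measurable (rule t)) (t : ℕ) (z : X) :
    P {ω | Real.sqrt (beta X m n δ (t + 1)) * ∑ j, Real.sqrt
        (postCov K₀ σ (dataset rule (fun x => h x ω) (fun s => ε s ω) t) z j j) <
      ∑ j, |h z ω j -
        postMean μ₀ K₀ σ (dataset rule (fun x => h x ω) (fun s => ε s ω) t) z j|} ≤
      ENNReal.ofReal (level X n δ t / 2) := by
  refine measure_dataset_le hh hε hσ hrule t z
    (fun D v => Real.sqrt (beta X m n δ (t + 1)) * ∑ j, Real.sqrt (postCov K₀ σ D z j j) <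
        ∑ j, |v j - postMean μ₀ K₀ σ D z j|) (fun a => ?_)
    fun D => measure_sum_abs_sub_postMean_gt_le hm hδ0 hδ hh hε hσ D z
  have h1 : Measurable fun p : (Fin t × Fin m → ℝ) × Vec m =>
      postMean μ₀ K₀ σ (stackedData a p.1) z :=
    (measurable_postMean_stackedData a z).comp measurable_fst
  exact measurableSet_lt (measurable_const (a := Real.sqrt (beta X m n δ (t + 1)) *
    ∑ j, Real.sqrt (postCov K₀ σ (stackedData a (0 : Fin t × Fin m → ℝ)) z j j))) (by fun_prop)

/-- With probability at least `1 - δ`, all upper bounds are valid and the sample stays within the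
confidence region around all posterior means. -/
theorem exists_confidence_event (hm : 0 < m) (hδ0 : 0 < δ) (hδ : δ < 1)
    (hL : ∀ i x y z, |g i x y - g i x z| ≤ L i * ∑ j, |y j - z j|)
    (hh : IsGPSample P μ₀ K₀ h) (hε : IsGaussianNoise P σ h ε) (hσ : 0 < σ)
    (hrule : ∀ t, Measurable (rule t)) :
    ∃ E : Set Ω, MeasurableSet E ∧ ENNReal.ofReal (1 - δ) ≤ P E ∧ ∀ ω ∈ E, ∀ t z,
      (∀ i, g i z (h z ω) ≤
        upper μ₀ K₀ σ δ g i (dataset rule (fun x => h x ω) (fun s => ε s ω) t) z) ∧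
      ∑ j, |h z ω j - postMean μ₀ K₀ σ (dataset rule (fun x => h x ω) (fun s => ε s ω) t) z j| ≤
        Real.sqrt (beta X m n δ (t + 1)) * ∑ j, Real.sqrt
          (postCov K₀ σ (dataset rule (fun x => h x ω) (fun s => ε s ω) t) z j j) := by
  let U : ℕ → X → Fin (n + 1) → Set Ω := fun t z i =>
    {ω | upper μ₀ K₀ σ δ g i (dataset rule (fun x => h x ω) (fun s => ε s ω) t) z <
      g i z (h z ω)}
  let V : ℕ → X → Set Ω := fun t z => {ω | Real.sqrt (beta X m n δ (t + 1)) * ∑ j, Real.sqrt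
        (postCov K₀ σ (dataset rule (fun x => h x ω) (fun s => ε s ω) t) z j j) <
      ∑ j, |h z ω j -
        postMean μ₀ K₀ σ (dataset rule (fun x => h x ω) (fun s => ε s ω) t) z j|}
  -- `V` does not depend on `i` but is counted once per `i`, so that each triple costs exactly one
  -- level.
  set N : Set Ω := ⋃ t, ⋃ z, ⋃ i, (U t z i ∪ V t z) with hN
  have hlev := level_pos (X := X) (n := n) (δ := δ) hδ0
  have hPN : P N ≤ ENNReal.ofReal δ := by
    calc P N ≤ ∑' t, P (⋃ z, ⋃ i, (U t z i ∪ V t z)) := measure_iUnion_le _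
      _ ≤ ∑' t, ENNReal.ofReal (Fintype.card X * ((n + 1) * level X n δ t)) := by
          refine ENNReal.tsum_le_tsum fun t => ?_
          calc P (⋃ z, ⋃ i, (U t z i ∪ V t z))
              ≤ ∑ z, ∑ i, P (U t z i ∪ V t z) :=
                (measure_iUnion_fintype_le _ _).trans
                  (Finset.sum_le_sum fun z _ => measure_iUnion_fintype_le _ _)
            _ ≤ ∑ _z : X, ∑ _i : Fin (n + 1), ENNReal.ofReal (level X n δ t) := by
                refine Finset.sum_le_sum fun z _ => Finset.sum_le_sum fun i _ => ?_
                refine (measure_union_le _ _).trans ((add_le_add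
                  (measure_dataset_upper_lt_le hδ0 hδ hL hh hε hσ hrule t z i)
                  (measure_dataset_sum_abs_gt_le (n := n) hm hδ0 hδ hh hε hσ hrule t z)).trans_eq ?_)
                rw [← ENNReal.ofReal_add (by linarith [hlev t]) (by linarith [hlev t]), add_halves]
            _ = _ := by
                have : ((n + 1 : ℕ) : ℝ) = n + 1 := by push_cast; rfl
                rw [Finset.sum_const, Finset.sum_const, nsmul_eq_mul, nsmul_eq_mul,
                  ENNReal.ofReal_mul (by positivity), ENNReal.ofReal_mul (by positivity),
                  Finset.card_univ, Finset.card_univ, Fintype.card_fin, ← this,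
                  ENNReal.ofReal_natCast, ENNReal.ofReal_natCast]
      _ = ENNReal.ofReal δ := by
          have hs := hasSum_level (X := X) (n := n) hδ0
          rw [← ENNReal.ofReal_tsum_of_nonneg (fun t => by
            have := hlev t
            positivity) hs.summable, hs.tsum_eq]
  -- A measurable hull of the same measure avoids proving `N` measurable.
  refine ⟨(toMeasurable P N)ᶜ, (measurableSet_toMeasurable _ _).compl, ?_, fun ω hω t z => ?_⟩
  · rw [prob_compl_eq_one_sub (measurableSet_toMeasurable _ _), measure_toMeasurable,
      ENNReal.ofReal_sub _ hδ0.le, ENNReal.ofReal_one]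
    exact tsub_le_tsub_left hPN _
  · have hωN : ω ∉ N := fun hc => hω (subset_toMeasurable P N hc)
    simp only [hN, Set.mem_iUnion, Set.mem_union, not_exists, not_or] at hωN
    exact ⟨fun i => not_lt.1 (hωN t z i).1, not_lt.1 (hωN t z 0).2⟩

end Confidence

/-! ### Optimism -/

section Regret

variable {X : Type*} [Fintype X] {m n : ℕ}
  {μ₀ : X → Vec m} {K₀ : X → X → Matrix (Fin m) (Fin m) ℝ} {σ δ : ℝ}
  {g : Fin (n + 1) → X → Vec m → ℝ} {rule : (t : ℕ) → Data X m t → X}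
  {f : X → Vec m} {e : ℕ → Vec m}

theorem isAuxMaximizer_query (hrule : ∀ (t : ℕ) (D : Data X m t),
      (auxFeasible μ₀ K₀ σ δ g D).Nonempty → IsAuxMaximizer μ₀ K₀ σ δ g D (rule t D))
    (hf : (feasibleSet g f).Nonempty) {t : ℕ}
    (hup : ∀ z i, g i z (f z) ≤ upper μ₀ K₀ σ δ g i (dataset rule f e t) z) :
    ¬ DeclaresInfeasible μ₀ K₀ σ δ g (dataset rule f e t) ∧
      IsAuxMaximizer μ₀ K₀ σ δ g (dataset rule f e t) (query rule f e t) := by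
  obtain ⟨z, hz⟩ := hf
  have hz' : z ∈ auxFeasible μ₀ K₀ σ δ g (dataset rule f e t) :=
    fun i => (hz i).trans (hup z i.succ)
  exact ⟨fun ⟨i, hi⟩ => absurd (hi z) (not_lt.2 (hz' i)), hrule t _ ⟨z, hz'⟩⟩

/-- The true optimizer competes in the auxiliary problem, so `f₀⋆ ≤ u₀(z) ≤ u₀(x)`. The positive
part comes free because `u₀(x) ≥ f₀(x)`. -/
theorem regret_le_upper_sub {t : ℕ} {D : Data X m t} {x : X} (hx : IsAuxMaximizer μ₀ K₀ σ δ g D x)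
    (hf : (feasibleSet g f).Nonempty) (hup : ∀ z i, g i z (f z) ≤ upper μ₀ K₀ σ δ g i D z) :
    max (optValue g f - g 0 x (f x)) 0 ≤ upper μ₀ K₀ σ δ g 0 D x - g 0 x (f x) := by
  obtain ⟨z, hz, hopt⟩ := optValue_mem hf
  have hz' : z ∈ auxFeasible μ₀ K₀ σ δ g D := fun i => (hz i).trans (hup z i.succ)
  have h1 : upper μ₀ K₀ σ δ g 0 D z ≤ upper μ₀ K₀ σ δ g 0 D x := hx.2 hz'
  have h2 := hup z 0
  have h3 := hup x 0
  rw [← hopt]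
  exact max_le (by linarith) (by linarith)

theorem violation_le_upper_sub {t : ℕ} {D : Data X m t} {x : X} (hx : IsAuxMaximizer μ₀ K₀ σ δ g D x)
    (hup : ∀ z i, g i z (f z) ≤ upper μ₀ K₀ σ δ g i D z) (i : Fin n) :
    max (-g i.succ x (f x)) 0 ≤ upper μ₀ K₀ σ δ g i.succ D x - g i.succ x (f x) := by
  have h1 := hx.1 i
  have h3 := hup x i.succ
  exact max_le (by linarith) (by linarith)

end Regret

end CUQB

/-! ### Main theorem -/

theorem mainTheorem1 {Ω : Type*} [MeasurableSpace Ω] (P : Measure Ω) [IsProbabilityMeasure P]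
    {X : Type*} [Fintype X] [Nonempty X] [MeasurableSpace X] [DiscreteMeasurableSpace X]
    {m n : ℕ} (hm : 0 < m)
    (μ₀ : X → CUQB.Vec m) (K₀ : X → X → Matrix (Fin m) (Fin m) ℝ)
    (σ : ℝ) (hσ : 0 < σ) (δ : ℝ) (hδ : δ ∈ Set.Ioo (0 : ℝ) 1)
    (g : Fin (n + 1) → X → CUQB.Vec m → ℝ) (L : Fin (n + 1) → ℝ)
    (hL : ∀ i x y z, |g i x y - g i x z| ≤ L i * ∑ j, |y j - z j|)
    (h : X → Ω → CUQB.Vec m) (ε : ℕ → Ω → CUQB.Vec m)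
    (hh : CUQB.IsGPSample P μ₀ K₀ h) (hε : CUQB.IsGaussianNoise P σ h ε)
    (rule : (t : ℕ) → CUQB.Data X m t → X)
    (hrule : CUQB.IsQueryRule μ₀ K₀ σ δ g rule) :
    let f : Ω → X → CUQB.Vec m := fun ω x => h x ω
    let D : Ω → (t : ℕ) → CUQB.Data X m t := fun ω => CUQB.dataset rule (f ω) (fun t => ε t ω)
    let x : Ω → ℕ → X := fun ω => CUQB.query rule (f ω) (fun t => ε t ω)
    ∃ E : Set Ω, MeasurableSet E ∧ ENNReal.ofReal (1 - δ) ≤ P E ∧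
      -- the algorithm never stops, and all its query points are well defined
      (∀ ω ∈ E, (CUQB.feasibleSet g (f ω)).Nonempty → ∀ t,
        ¬ CUQB.DeclaresInfeasible μ₀ K₀ σ δ g (D ω t) ∧
          CUQB.IsAuxMaximizer μ₀ K₀ σ δ g (D ω t) (x ω t)) ∧
      (∀ ω ∈ E, (CUQB.feasibleSet g (f ω)).Nonempty → ∀ T,
        CUQB.cumRegret g (f ω) (x ω) T ≤ CUQB.cumPosRegret g (f ω) (x ω) T) ∧
      -- the explicit bounds, for normalized kernels
      ((∀ j z, K₀ z z j j ≤ 1) →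
        ∀ ω ∈ E, (CUQB.feasibleSet g (f ω)).Nonempty → ∀ T : ℕ, 1 ≤ T → σ ^ 2 ≤ 1 + 2 / (T : ℝ) →
          CUQB.cumPosRegret g (f ω) (x ω) T
              ≤ 4 * L 0 * Real.sqrt (CUQB.beta X m n δ T) * CUQB.Psi K₀ σ T ∧
            ∀ i : Fin n, CUQB.cumViolation g (f ω) (x ω) i T
              ≤ 4 * L i.succ * Real.sqrt (CUQB.beta X m n δ T) * CUQB.Psi K₀ σ T) ∧
      (∀ i, CUQB.IsSoftO
        (fun T => 4 * L i * Real.sqrt (CUQB.beta X m n δ T) * CUQB.Psi K₀ σ T)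
        (fun T => Real.sqrt (CUQB.maxInfoGainMax K₀ σ T * T))) ∧
      -- the rates, without normalization and uniformly over the event
      (∃ B : ℕ → ℝ, CUQB.IsSoftO B (fun T => Real.sqrt (CUQB.maxInfoGainMax K₀ σ T * T)) ∧
        ∀ ω ∈ E, (CUQB.feasibleSet g (f ω)).Nonempty → ∀ T : ℕ, 1 ≤ T →
          CUQB.cumPosRegret g (f ω) (x ω) T ≤ B T ∧
            ∀ i : Fin n, CUQB.cumViolation g (f ω) (x ω) i T ≤ B T) := by
  intro f D x
  obtain ⟨hδ0, hδ1⟩ := hδ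
  obtain ⟨E, hE, hPE, hconf⟩ :=
    CUQB.exists_confidence_event (n := n) hm hδ0 hδ1 hL hh hε hσ hrule.measurable
  have hL0 : ∀ i, 0 ≤ L i := fun i =>
    CUQB.lipschitz_const_nonneg hm (hL i (Classical.arbitrary X))
  have hγ := CUQB.maxInfoGain_nonneg hh hε hσ
  have haux : ∀ ω ∈ E, (CUQB.feasibleSet g (f ω)).Nonempty → ∀ t,
      ¬ CUQB.DeclaresInfeasible μ₀ K₀ σ δ g (D ω t) ∧
        CUQB.IsAuxMaximizer μ₀ K₀ σ δ g (D ω t) (x ω t) := fun ω hω hf t =>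
    CUQB.isAuxMaximizer_query hrule.isAuxMaximizer hf fun z => (hconf ω hω t z).1
  -- The factor 2: one radius from the quantile to the value at the posterior mean, another from
  -- there to the true value.
  have hwidth : ∀ ω ∈ E, ∀ t z i,
      CUQB.upper μ₀ K₀ σ δ g i (D ω t) z - g i z (f ω z) ≤
        2 * L i * (Real.sqrt (CUQB.beta X m n δ (t + 1)) *
          ∑ j, Real.sqrt (CUQB.postCov K₀ σ (D ω t) z j j)) := by
    intro ω hω t z i
    have h1 := CUQB.upper_le hm hδ0 hδ1 hL hh hε hσ i (D ω t) z
    have h2 := (neg_abs_le _).trans' (neg_le_neg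
      (hL i z (f ω z) (CUQB.postMean μ₀ K₀ σ (D ω t) z)))
    have h3 := mul_le_mul_of_nonneg_left (hconf ω hω t z).2 (hL0 i)
    change L i * ∑ j, |f ω z j - CUQB.postMean μ₀ K₀ σ (D ω t) z j| ≤
      L i * (Real.sqrt (CUQB.beta X m n δ (t + 1)) *
          ∑ j, Real.sqrt (CUQB.postCov K₀ σ (D ω t) z j j)) at h3
    linarith
  have hsum : ∀ κ : ℝ, (∀ j z, K₀ z z j j ≤ κ) → ∀ ω ∈ E, ∀ (T : ℕ) (i : Fin (n + 1)) (r : ℕ → ℝ),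
      (∀ t, r t ≤ CUQB.upper μ₀ K₀ σ δ g i (D ω t) (x ω t) - g i (x ω t) (f ω (x ω t))) →
      ∑ t ∈ Finset.range T, r t ≤ 2 * L i * Real.sqrt (CUQB.beta X m n δ T) *
        ∑ j, Real.sqrt ((2 * σ ^ 2 + κ) * T * CUQB.maxInfoGain K₀ σ j T) := by
    intro κ hκ ω hω T i r hr
    have hLi := hL0 i
    calc ∑ t ∈ Finset.range T, r t
        ≤ ∑ t ∈ Finset.range T, 2 * L i * Real.sqrt (CUQB.beta X m n δ T) *
          ∑ j, Real.sqrt (CUQB.postCov K₀ σ (D ω t) (x ω t) j j) := by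
          refine Finset.sum_le_sum fun t ht => (hr t).trans ((hwidth ω hω t _ i).trans ?_)
          rw [← mul_assoc]
          -- Steps are indexed from zero, so `t < T` gives `t + 1 ≤ T` and `β_T` dominates.
          have hβ := CUQB.beta_mono (X := X) (n := n) hm hδ0 hδ1 (s := t + 1) (by omega)
            (Finset.mem_range.1 ht)
          have hs : 0 ≤ ∑ j, Real.sqrt (CUQB.postCov K₀ σ (D ω t) (x ω t) j j) :=
            Finset.sum_nonneg fun _ _ => Real.sqrt_nonneg _
          gcongr
      _ ≤ _ := by
          rw [← Finset.mul_sum]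
          exact mul_le_mul_of_nonneg_left
            (CUQB.sum_sqrt_postCov_le hh hε hσ rule (f ω) (fun t => ε t ω) hκ T) (by positivity)
  have hreg : ∀ κ : ℝ, (∀ j z, K₀ z z j j ≤ κ) → ∀ ω ∈ E,
      (CUQB.feasibleSet g (f ω)).Nonempty → ∀ T : ℕ,
      CUQB.cumPosRegret g (f ω) (x ω) T ≤ 2 * L 0 * Real.sqrt (CUQB.beta X m n δ T) *
        ∑ j, Real.sqrt ((2 * σ ^ 2 + κ) * T * CUQB.maxInfoGain K₀ σ j T) ∧
      ∀ i : Fin n, CUQB.cumViolation g (f ω) (x ω) i T ≤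
        2 * L i.succ * Real.sqrt (CUQB.beta X m n δ T) *
          ∑ j, Real.sqrt ((2 * σ ^ 2 + κ) * T * CUQB.maxInfoGain K₀ σ j T) :=
    fun κ hκ ω hω hf T =>
      ⟨hsum κ hκ ω hω T 0 _ fun t => CUQB.regret_le_upper_sub (haux ω hω hf t).2 hf
        fun z => (hconf ω hω t z).1,
      fun i => hsum κ hκ ω hω T i.succ _ fun t => CUQB.violation_le_upper_sub (haux ω hω hf t).2
        (fun z => (hconf ω hω t z).1) i⟩
  refine ⟨E, hE, hPE, haux, fun ω _ _ T => CUQB.cumRegret_le_cumPosRegret _ _ _ _, ?_, ?_, ?_⟩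
  · intro hκ ω hω hf T hT hσT
    have hT' : (0 : ℝ) < T := by exact_mod_cast hT
    have hcomp : ∀ i, 2 * L i * Real.sqrt (CUQB.beta X m n δ T) *
        ∑ j, Real.sqrt ((2 * σ ^ 2 + 1) * T * CUQB.maxInfoGain K₀ σ j T) ≤
          4 * L i * Real.sqrt (CUQB.beta X m n δ T) * CUQB.Psi K₀ σ T := by
      intro i
      have h1 : ∑ j, Real.sqrt ((2 * σ ^ 2 + 1) * T * CUQB.maxInfoGain K₀ σ j T) ≤
          2 * CUQB.Psi K₀ σ T := by
        rw [CUQB.Psi, Finset.mul_sum]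
        refine Finset.sum_le_sum fun j _ => ?_
        rw [Real.sqrt_le_left (by positivity), mul_pow,
          Real.sq_sqrt (mul_nonneg (by positivity) (hγ j T)), ← mul_assoc]
        refine mul_le_mul_of_nonneg_right ?_ (hγ j T)
        -- This is where the restriction on `σ` enters: `(2σ² + 1) T ≤ 3T + 4 ≤ 4 (T + 2)`, whose
        -- square root gives the second factor 2.
        have h2 : σ ^ 2 * T ≤ T + 2 := by
          calc σ ^ 2 * T ≤ (1 + 2 / T) * T := by gcongr
            _ = T + 2 := by field_simp
        linarith
      have h3 : 0 ≤ 2 * L i * Real.sqrt (CUQB.beta X m n δ T) := by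
        have := hL0 i
        positivity
      linarith [mul_le_mul_of_nonneg_left h1 h3]
    have h := hreg 1 hκ ω hω hf T
    exact ⟨h.1.trans (hcomp 0), fun i => (h.2 i).trans (hcomp i.succ)⟩
  · intro i
    refine CUQB.isSoftO_sqrt_beta_mul hm hδ0 hδ1 hγ (4 * L i) 3 (by norm_num)
      (w := fun T => (T : ℝ) + 2) fun T hT => ?_
    have hT' : (1 : ℝ) ≤ T := by exact_mod_cast hT
    linarith
  · obtain ⟨κ, hκ⟩ := (Set.finite_range fun p : Fin m × X => K₀ p.2 p.2 p.1 p.1).bddAbove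
    replace hκ : ∀ j z, K₀ z z j j ≤ κ := fun j z => hκ ⟨(j, z), rfl⟩
    have hκ0 : 0 ≤ κ := (hh.posSemidef (fun _ : Fin 1 => Classical.arbitrary X)
      (fun _ => ⟨0, hm⟩)).diag_nonneg (i := 0) |>.trans (hκ _ _)
    -- The sum of the Lipschitz constants dominates each of them, so one sequence serves the regret
    -- and all violations.
    refine ⟨fun T => 2 * (∑ i, L i) * Real.sqrt (CUQB.beta X m n δ T) *
      ∑ j, Real.sqrt ((2 * σ ^ 2 + κ) * T * CUQB.maxInfoGain K₀ σ j T), ?_, ?_⟩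
    · exact CUQB.isSoftO_sqrt_beta_mul hm hδ0 hδ1 hγ _ (2 * σ ^ 2 + κ) (by positivity)
        (w := fun T => (2 * σ ^ 2 + κ) * T) fun T _ => le_rfl
    · intro ω hω hf T _
      have hcomp : ∀ i, 2 * L i * Real.sqrt (CUQB.beta X m n δ T) *
          ∑ j, Real.sqrt ((2 * σ ^ 2 + κ) * T * CUQB.maxInfoGain K₀ σ j T) ≤
          2 * (∑ i, L i) * Real.sqrt (CUQB.beta X m n δ T) *
            ∑ j, Real.sqrt ((2 * σ ^ 2 + κ) * T * CUQB.maxInfoGain K₀ σ j T) := fun i => by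
        have h1 := Finset.single_le_sum (fun i _ => hL0 i) (Finset.mem_univ i)
        gcongr
      have h := hreg κ hκ ω hω hf T
      exact ⟨h.1.trans (hcomp 0), fun i => (h.2 i).trans (hcomp i.succ)⟩
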